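/- Let $d,m\ge 0$ be integers, write $M=\mathbb R^d$, let $H$ be a subgroup of $GL(d)=GL(M)$ containing all scalings $c\cdot\mathrm{id}$, $c\in\mathbb R\setminus\{0\}$, and let $G=H\ltimes\mathbb R^d$ be the group of affine maps $x\mapsto Ax+b$ with $A\in H$, $b\in\mathbb R^d$, acting on smooth vector fields by $((A,b)\cdot f)(x)=A\,f(A^{-1}(x-b))$. Let $\mathfrak X(\mathbb R^d)$ be the Fréchet space of smooth vector fields on $\mathbb R^d$ (uniform convergence of all derivatives on compact sets), and let $\mathcal L_m$ be the vector space of continuous symmetric $m$-linear maps $\varphi:\mathfrak X(\mathbb R^d)^m\to\mathfrak X(\mathbb R^d)$ that are $G$-equivariant, $\varphi(g\cdot f_1,\dots,g\cdot f_m)=g\cdot\varphi(f_1,\dots,f_m)$ for $g\in G$, and local, i.e. support non-increasing: $\operatorname{supp}\varphi(f_1,\dots,f_m)\subseteq\operatorname{supp}(f_1,\dots,f_m)$, where $(f_1,\dots,f_m)$ is viewed as a section of $\bigoplus^m T\mathbb R^d$. A composition is a finitely supported map $\kappa:\mathbb N\to\mathbb N$ (with $0\in\mathbb N$); its size is $|\kappa|=\sum_j\kappa(j)$,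 and its derived composition is $\kappa'(j)=j\,\kappa(j)$. Put $$\mathrm{Sym}_\kappa = M\otimes\bigotimes_{j\ge 0}\mathrm{sym}^{\kappa(j)}\bigl(M^*\otimes \mathrm{sym}^j M\bigr),$$ with the tensor product action of $H$, and let $\mathrm{Sym}_\kappa^H$ be its subspace of $H$-invariant elements. Then there is a linear isomorphism $$\mathcal L_m\;\cong\;\bigoplus_{\substack{|\kappa|=m\\ |\kappa'|=m-1}}\mathrm{Sym}_\kappa^H ,\qquad \varphi\mapsto(S_\kappa)_\kappa ,$$ such that for every $\varphi\in\mathcal L_m$ and every vector field $f$ one has $\varphi(f,\dots,f)(0)=\sum_\kappa\langle S_\kappa,f\rangle$, where $\langle S_\kappa,f\rangle\in M$ is the contraction of $S_\kappa$ with $\kappa(j)$ copies of the derivative $f^{(j)}(0)\in \mathrm{Lin}(\mathrm{sym}^jM,M)$ for each $j$, given on products by $x\otimes\bigotimes_j\prod_{i=1}^{\kappa(j)}(\xi_{j,i}\otimes s_{j,i})\mapsto\prod_{j}\prod_{i}\xi_{j,i}\bigl(f^{(j)}(0)\,s_{j,i}\bigr)\,x$. In particular, $\mathcal L_m$ is finite-dimensional.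 -/

import Mathlib

open scoped ContDiff TensorProduct DirectSum

noncomputable section

namespace LocalEquivariant

/-! ### Smooth vector fields on `ℝ^d` with their Fréchet topology -/

/-- The space `ℝ^d`; it is also the tangent space at the origin. -/
abbrev Space (d : ℕ) : Type := EuclideanSpace ℝ (Fin d)

/-- The smooth maps `ℝ^d → ℝ^d`. -/
def smoothMaps (d : ℕ) : Submodule ℝ (Space d → Space d) where
  carrier := {f | ContDiff ℝ ∞ f}
  add_mem' {f g} (hf : ContDiff ℝ ∞ f) (hg : ContDiff ℝ ∞ g) := hf.add hg
  zero_mem' := show ContDiff ℝ ∞ (fun _ : Space d => (0 : Space d)) from contDiff_const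
  smul_mem' c f (hf : ContDiff ℝ ∞ f) := hf.const_smul c

/-- Smooth vector fields on `ℝ^d`. This is a separate type, since the subspace topology of the
topology of pointwise convergence is not the one to be used. -/
def VectorField (d : ℕ) : Type := smoothMaps d

namespace VectorField

variable {d : ℕ}

instance : AddCommGroup (VectorField d) := inferInstanceAs (AddCommGroup (smoothMaps d))

instance : Module ℝ (VectorField d) := inferInstanceAs (Module ℝ (smoothMaps d))

instance : CoeFun (VectorField d) (fun _ => Space d → Space d) := ⟨fun f => f.1⟩

theorem contDiff (f : VectorField d) : ContDiff ℝ ∞ (f : Space d → Space d) := f.2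

/-- The `k`-th derivative, as a continuous function on `ℝ^d`. -/
def iteratedDerivative (k : ℕ) :
    VectorField d →ₗ[ℝ] C(Space d, ContinuousMultilinearMap ℝ (fun _ : Fin k => Space d) (Space d))
    where
  toFun f := ⟨iteratedFDeriv ℝ k f, f.contDiff.continuous_iteratedFDeriv (by exact_mod_cast le_top)⟩
  map_add' f g := by
    ext1 x
    exact iteratedFDeriv_add_apply (f.contDiff.contDiffAt.of_le (by exact_mod_cast le_top))
      (g.contDiff.contDiffAt.of_le (by exact_mod_cast le_top))
  map_smul' c f := by
    ext1 x
    exact iteratedFDeriv_const_smul_apply (f.contDiff.contDiffAt.of_le (by exact_mod_cast le_top))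

/-- The Fréchet topology: uniform convergence on compact sets of all derivatives. -/
instance : TopologicalSpace (VectorField d) :=
  ⨅ k : ℕ, TopologicalSpace.induced (iteratedDerivative k) inferInstance

instance : IsTopologicalAddGroup (VectorField d) :=
  topologicalAddGroup_iInf fun k => topologicalAddGroup_induced (iteratedDerivative (d := d) k)

instance : ContinuousSMul ℝ (VectorField d) :=
  continuousSMul_iInf fun k => continuousSMul_induced (iteratedDerivative (d := d) k)

/-- The action of an affine transformation `g x = A x + b` on vector fields:
`(g • f) x = A (f (g⁻¹ x))`, with `A` the tangent map of `g`. -/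
def affineAct (g : Space d ≃ᵃ[ℝ] Space d) (f : VectorField d) : VectorField d :=
  ⟨fun x => g.linear (f (g.symm x)), by
    have h₁ : ContDiff ℝ ∞ (g.linear : Space d → Space d) :=
      g.linear.toContinuousLinearEquiv.contDiff
    have h₂ : ContDiff ℝ ∞ (g.symm : Space d → Space d) :=
      ContinuousAffineMap.contDiff
        ⟨g.symm.toAffineMap, AffineMap.continuous_of_finiteDimensional _⟩
    exact h₁.comp (f.contDiff.comp h₂)⟩

end VectorField

/-! ### Local equivariant symmetric multilinear maps -/

/-- The group `G = H ⋉ ℝ^d` of the affine transformations of `ℝ^d` with linear part in `H`. -/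
def affineGroup {d : ℕ} (H : Subgroup (Space d ≃ₗ[ℝ] Space d)) :
    Subgroup (Space d ≃ᵃ[ℝ] Space d) :=
  H.comap AffineEquiv.linearHom

/-- The space of continuous symmetric `m`-linear maps on vector fields that are
equivariant under `G = H ⋉ ℝ^d` and local, i.e. support non-increasing; here an `m`-tuple of
vector fields is regarded as one section of the `m`-fold Whitney sum of the tangent bundle. -/
def localEquivariantMaps {d : ℕ} (H : Subgroup (Space d ≃ₗ[ℝ] Space d)) (m : ℕ) :
    Submodule ℝ (ContinuousMultilinearMap ℝ (fun _ : Fin m => VectorField d) (VectorField d)) where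
  carrier := {φ |
    (∀ (σ : Equiv.Perm (Fin m)) (f : Fin m → VectorField d), φ (fun i => f (σ i)) = φ f) ∧
    (∀ f : Fin m → VectorField d, tsupport (φ f) ⊆ tsupport (fun x (i : Fin m) => f i x)) ∧
    (∀ g ∈ affineGroup H, ∀ f : Fin m → VectorField d,
      φ (fun i => (f i).affineAct g) = (φ f).affineAct g)}
  add_mem' := by
    rintro φ ψ ⟨h₁, h₂, h₃⟩ ⟨k₁, k₂, k₃⟩
    refine ⟨fun σ f => ?_, fun f => ?_, fun g hg f => ?_⟩
    · simp [h₁ σ f, k₁ σ f]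
    · exact (tsupport_add (φ f : Space d → Space d) (ψ f)).trans (Set.union_subset (h₂ f) (k₂ f))
    · simp only [add_apply, h₃ g hg f, k₃ g hg f]
      exact Subtype.ext (funext fun x => (map_add g.linear _ _).symm)
  zero_mem' := by
    refine ⟨fun σ f => rfl, fun f => ?_, fun g hg f => ?_⟩
    · have : tsupport ((0 : VectorField d) : Space d → Space d) = ∅ :=
        tsupport_eq_empty_iff.mpr rfl
      exact this.le.trans (Set.empty_subset _)
    · exact Subtype.ext (funext fun x => (map_zero g.linear).symm)
  smul_mem' := by
    rintro c φ ⟨h₁, h₂, h₃⟩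
    refine ⟨fun σ f => ?_, fun f => ?_, fun g hg f => ?_⟩
    · simp [h₁ σ f]
    · refine (closure_mono ?_).trans (h₂ f)
      exact Function.support_const_smul_subset c (φ f : Space d → Space d)
    · simp only [smul_apply, h₃ g hg f]
      exact Subtype.ext (funext fun x => (map_smul g.linear c _).symm)

/-! ### Symmetric powers -/

section SymmetricPower

variable {V W : Type} [AddCommMonoid V] [Module ℝ V] [AddCommMonoid W] [Module ℝ W] {n : ℕ}

/-- The linear map on the symmetric power induced by a symmetric multilinear map. -/
def symLift (g : MultilinearMap ℝ (fun _ : Fin n => V) W)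
    (hg : ∀ (σ : Equiv.Perm (Fin n)) (v : Fin n → V), g (fun i => v (σ i)) = g v) :
    Sym[ℝ]^n V →ₗ[ℝ] W where
  __ := AddCon.lift (addConGen (SymmetricPower.Rel ℝ (Fin n) V))
    (PiTensorProduct.lift g).toAddMonoidHom (AddCon.addConGen_le.mpr (by
      rintro _ _ ⟨σ, v⟩
      refine (AddCon.ker_rel _).mpr ?_
      rw [LinearMap.toAddMonoidHom_coe, PiTensorProduct.lift.tprod, PiTensorProduct.lift.tprod,
        hg σ v]))
  map_smul' c x := AddCon.induction_on x fun x => map_smul (PiTensorProduct.lift g) c x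

@[simp]
theorem symLift_tprod (g : MultilinearMap ℝ (fun _ : Fin n => V) W)
    (hg : ∀ (σ : Equiv.Perm (Fin n)) (v : Fin n → V), g (fun i => v (σ i)) = g v)
    (v : Fin n → V) : symLift g hg (SymmetricPower.tprod ℝ v) = g v :=
  PiTensorProduct.lift.tprod (φ := g) v

theorem sym_hom_ext {p q : Sym[ℝ]^n V →ₗ[ℝ] W}
    (h : ∀ v : Fin n → V, p (SymmetricPower.tprod ℝ v) = q (SymmetricPower.tprod ℝ v)) : p = q :=
  LinearMap.ext_on_range (SymmetricPower.span_tprod_eq_top ℝ (Fin n) V) h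

/-- Functoriality of the symmetric power. -/
def symMap (n : ℕ) (p : V →ₗ[ℝ] W) : Sym[ℝ]^n V →ₗ[ℝ] Sym[ℝ]^n W :=
  symLift ((SymmetricPower.tprod ℝ).compLinearMap fun _ => p) fun σ v =>
    SymmetricPower.tprod_equiv σ fun i => p (v i)

@[simp]
theorem symMap_tprod (p : V →ₗ[ℝ] W) (v : Fin n → V) :
    symMap n p (SymmetricPower.tprod ℝ v) = SymmetricPower.tprod ℝ fun i => p (v i) :=
  symLift_tprod _ _ v

/-- The action of a group on the symmetric power of a representation. -/
def symRep {G : Type} [Group G] (n : ℕ) (ρ : Representation ℝ G V) :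
    Representation ℝ G (Sym[ℝ]^n V) where
  toFun g := symMap n (ρ g)
  map_one' := sym_hom_ext fun v => by simp
  map_mul' g h := sym_hom_ext fun v => by simp

/-- A linear form `l` on `V` extended multiplicatively: `v₁ ⋯ vₙ ↦ l v₁ * ⋯ * l vₙ`. -/
def symEval (n : ℕ) (l : V →ₗ[ℝ] ℝ) : Sym[ℝ]^n V →ₗ[ℝ] ℝ :=
  symLift ((MultilinearMap.mkPiAlgebra ℝ (Fin n) ℝ).compLinearMap fun _ => l) fun σ v => by
    simpa using Equiv.prod_comp σ fun i => l (v i)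

end SymmetricPower

/-! ### Compositions and the spaces of symmetries -/

/-- A composition: a finitely supported map `ℕ → ℕ`. -/
abbrev NatComposition : Type := ℕ →₀ ℕ

/-- The size `|κ| = ∑ j, κ j`. -/
def NatComposition.size (κ : NatComposition) : ℕ := κ.sum fun _ n => n

/-- The derived composition `κ' j = j * κ j`. -/
def NatComposition.derived (κ : NatComposition) : NatComposition :=
  Finsupp.onFinset κ.support (fun j => j * κ j) fun _ hj =>
    Finsupp.mem_support_iff.mpr (right_ne_zero_of_mul hj)

/-- `M* ⊗ sym^j M` with `M = ℝ^d`. -/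
abbrev Factor (d j : ℕ) : Type := Module.Dual ℝ (Space d) ⊗[ℝ] Sym[ℝ]^j (Space d)

/-- `Sym_κ = M ⊗ ⨂_j sym^{κ j} (M* ⊗ sym^j M)`. The factors with `κ j = 0` are copies of `ℝ` and
are left out. -/
abbrev SymSpace (d : ℕ) (κ : NatComposition) : Type :=
  Space d ⊗[ℝ] (⨂[ℝ] j : κ.support, Sym[ℝ]^(κ j) (Factor d j))

/-- The defining representation of `H` on `M = ℝ^d`. -/
def stdRep {d : ℕ} (H : Subgroup (Space d ≃ₗ[ℝ] Space d)) : Representation ℝ H (Space d) where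
  toFun A := (A : Space d ≃ₗ[ℝ] Space d).toLinearMap
  map_one' := rfl
  map_mul' _ _ := rfl

/-- The tensor product action of `H` on `M* ⊗ sym^j M`. -/
def factorRep {d : ℕ} (H : Subgroup (Space d ≃ₗ[ℝ] Space d)) (j : ℕ) :
    Representation ℝ H (Factor d j) :=
  (stdRep H).dual.tprod (symRep j (stdRep H))

/-- The tensor product action of `H` on `⨂_j sym^{κ j} (M* ⊗ sym^j M)`. -/
def productRep {d : ℕ} (H : Subgroup (Space d ≃ₗ[ℝ] Space d)) (κ : NatComposition) :
    Representation ℝ H (⨂[ℝ] j : κ.support, Sym[ℝ]^(κ j) (Factor d j)) where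
  toFun A := PiTensorProduct.map fun j : κ.support => symRep (κ j) (factorRep H j) A
  map_one' := by simp only [map_one]; exact PiTensorProduct.map_one
  map_mul' A B := by simp only [map_mul]; exact PiTensorProduct.map_mul _ _

/-- The tensor product action of `H` on `Sym_κ`. -/
def symSpaceRep {d : ℕ} (H : Subgroup (Space d ≃ₗ[ℝ] Space d)) (κ : NatComposition) :
    Representation ℝ H (SymSpace d κ) :=
  (stdRep H).tprod (productRep H κ)

/-! ### Contraction with the jet of a vector field at the origin -/

theorem iteratedFDeriv_perm {E F : Type} [NormedAddCommGroup E] [NormedSpace ℝ E]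
    [NormedAddCommGroup F] [NormedSpace ℝ F] {f : E → F} (hf : ContDiff ℝ ∞ f) (n : ℕ) (x : E)
    (σ : Equiv.Perm (Fin n)) (v : Fin n → E) :
    iteratedFDeriv ℝ n f x (fun i => v (σ i)) = iteratedFDeriv ℝ n f x v := by
  have hd : ∀ k : ℕ, ContDiff ℝ ∞ (iteratedFDeriv ℝ k f) := fun k =>
    hf.iteratedFDeriv_right (m := ∞) (by exact_mod_cast le_top)
  induction n generalizing x with
  | zero => exact congrArg _ (Subsingleton.elim _ _)
  | succ n ih =>
    have tail : ∀ (τ : Equiv.Perm (Fin n)) (w : Fin (n + 1) → E) (y : E),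
        iteratedFDeriv ℝ (n + 1) f y (Fin.cons (w 0) fun i => w (τ i).succ) =
          iteratedFDeriv ℝ (n + 1) f y w := by
      intro τ w y
      have hdiff : DifferentiableAt ℝ (iteratedFDeriv ℝ n f) y :=
        (hd n).differentiable (by simp) y
      have key : ∀ u : Fin n → E,
          fderiv ℝ (iteratedFDeriv ℝ n f) y (w 0) u =
            fderiv ℝ (fun z => iteratedFDeriv ℝ n f z u) y (w 0) := by
        intro u
        rw [fderiv_continuousMultilinear_apply_const_apply hdiff]
      rw [iteratedFDeriv_succ_apply_left, iteratedFDeriv_succ_apply_left]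
      simp only [Fin.cons_zero, Fin.tail_cons]
      rw [key, key]
      congr 2
      funext z
      exact ih z τ (Fin.tail w)
    have hσ : σ ∈ Submonoid.closure
        (Set.range fun i : Fin n => Equiv.swap i.castSucc i.succ) := by
      rw [Equiv.Perm.mclosure_swap_castSucc_succ]; trivial
    induction hσ using Submonoid.closure_induction generalizing v with
    | one => rfl
    | mul a b _ _ ha hb => exact (hb fun i => v (a i)).trans (ha v)
    | mem τ hτ =>
      obtain ⟨i, rfl⟩ := hτ
      obtain ⟨n, rfl⟩ : ∃ k, n = k + 1 := ⟨n - 1, by have := i.2; omega⟩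
      refine Fin.cases ?_ (fun j => ?_) i
      · have hs := ((hd n).contDiffAt (x := x)).isSymmSndFDerivAt
          (by rw [minSmoothness_of_isRCLikeNormedField]; exact WithTop.coe_le_coe.mpr (le_top (a := (2 : ℕ∞))))
        have two : ∀ w : Fin (n + 2) → E, iteratedFDeriv ℝ (n + 2) f x w =
            fderiv ℝ (fderiv ℝ (iteratedFDeriv ℝ n f)) x (w 0) (w 1) (Fin.tail (Fin.tail w)) := by
          intro w
          have hdiff : DifferentiableAt ℝ (iteratedFDeriv ℝ (n + 1) f) x :=
            (hd (n + 1)).differentiable (by simp) x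
          have hdiff' : DifferentiableAt ℝ (fderiv ℝ (iteratedFDeriv ℝ n f)) x :=
            ((hd n).fderiv_right (m := ∞) (by simp)).differentiable (by simp) x
          have hdiff'' : DifferentiableAt ℝ
              (fun z => fderiv ℝ (iteratedFDeriv ℝ n f) z (w 1)) x :=
            hdiff'.clm_apply (differentiableAt_const _)
          rw [iteratedFDeriv_succ_apply_left,
            ← fderiv_continuousMultilinear_apply_const_apply hdiff]
          simp only [iteratedFDeriv_succ_apply_left]
          change fderiv ℝ (fun z => fderiv ℝ (iteratedFDeriv ℝ n f) z (w 1)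
            (Fin.tail (Fin.tail w))) x (w 0) = _
          rw [fderiv_continuousMultilinear_apply_const_apply hdiff'',
            fderiv_clm_apply hdiff' (differentiableAt_const _)]
          simp
        rw [two, two]
        have h0 : Equiv.swap (Fin.castSucc (0 : Fin (n + 1))) (Fin.succ 0) 0 = 1 := by
          simp
        have h1 : Equiv.swap (Fin.castSucc (0 : Fin (n + 1))) (Fin.succ 0) 1 = 0 := by
          simp
        simp only [h0, h1]
        rw [hs.eq]
        congr 1
      · rw [← tail (Equiv.swap j.castSucc j.succ) v x]
        congr 1
        funext k
        refine Fin.cases ?_ (fun l => ?_) k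
        · rw [Fin.cons_zero, Equiv.swap_apply_of_ne_of_ne] <;> simp [Fin.ext_iff]
        · refine congrArg v ?_
          exact ((Fin.succ_injective _).swap_apply j.castSucc j.succ l)

/-- The `j`-th derivative of `f` at the origin as a linear map `sym^j M → M`. -/
def taylorCoeff {d : ℕ} (f : VectorField d) (j : ℕ) : Sym[ℝ]^j (Space d) →ₗ[ℝ] Space d :=
  symLift (iteratedFDeriv ℝ j f 0).toMultilinearMap fun σ v =>
    iteratedFDeriv_perm f.contDiff j 0 σ v

/-- The contraction `ξ ⊗ s ↦ ξ (f^(j)(0) s)` of `M* ⊗ sym^j M` with `f^(j)(0)`. -/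
def factorEval {d : ℕ} (f : VectorField d) (j : ℕ) : Factor d j →ₗ[ℝ] ℝ :=
  contractLeft ℝ (Space d) ∘ₗ LinearMap.lTensor (Module.Dual ℝ (Space d)) (taylorCoeff f j)

/-- The contraction of an element of `Sym_κ` with `κ j` copies of `f^(j)(0)` for each `j`. -/
def symSpaceEval {d : ℕ} (f : VectorField d) (κ : NatComposition) : SymSpace d κ →ₗ[ℝ] Space d :=
  (TensorProduct.rid ℝ (Space d)).toLinearMap ∘ₗ
    LinearMap.lTensor (Space d)
      (PiTensorProduct.lift ((MultilinearMap.mkPiAlgebra ℝ κ.support ℝ).compLinearMap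
        fun j : κ.support => symEval (κ j) (factorEval f j)))

end LocalEquivariant

end

open LocalEquivariant

open scoped ContDiff TensorProduct DirectSum

noncomputable section

namespace LocalEquivariant

open Filter Topology

/-! Translations reduce everything to the origin, and polarization to the diagonal: an equivariant
symmetric map `φ` is determined by the function `f ↦ φ(f,…,f)(0)`. The proof compares two injections
into the space of functions from vector fields to `M`: `diagonalAtOrigin`, and `totalPairing`, which
sends `(S_κ)` to `f ↦ ∑ ⟨S_κ, f⟩`. They have the same range, and this gives the isomorphism.

From maps to tensors, the scalings do the analytic work, and Peetre's theorem is not needed.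
Equivariance under `x ↦ x/t` says that replacing all `f_i` by `f_i(t·)` multiplies `φ(f)(0)` by
`t^(m-1)`. If the derivatives of one `f_i` of order below `m` vanish at `0`, then `t^(1-m) f_i(t·)`
tends to `0` in the Fréchet topology as `t → 0+`, while the other arguments tend to constant fields.
Continuity then gives `φ(f)(0) = 0` (`IsEquivariant.apply_eq_zero_of_flat`). Thus only `(m-1)`-jets
matter, and locality is a consequence. Expanding Taylor polynomials into monomials makes the
diagonal a homogeneous polynomial of degree `m` in the jet; sorting factors by order of derivative
writes it as a sum of contractions with `|κ| = m` (`IsEquivariant.diagonal_mem_iSup`).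

The tensors in such a sum are unique (`eq_zero_of_sum_symSpaceEval_eq_zero`): jets can be prescribed
freely up to finite order, rescaling the `j`-th derivative by `t_j` separates the compositions by
the monomials `t^κ`, and powers of linear forms separate points of symmetric powers. Uniqueness
turns equivariance into `H`-invariance of each `S_κ`, and a single scaling then forces `|κ'| + 1 =
|κ|`.

From tensors to maps, a contraction is the diagonal of a multilinear map in the jets. Symmetrized
and applied to translates of the arguments, it gives the required equivariant map
(`exists_equivariant_of_mem_localDiagonals`). -/

/-! ### Polarization -/

/-- The polarization identity for a multilinear map. -/
theorem sum_diagonal_eq_sum_perm {ι V W : Type*} [Fintype ι] [DecidableEq ι] [AddCommGroup V]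
    [Module ℝ V] [AddCommGroup W] [Module ℝ W] (g : MultilinearMap ℝ (fun _ : ι => V) W)
    (x : ι → V) :
    ∑ T : Finset ι, (-1 : ℝ) ^ (Tᶜ).card • g (fun _ => ∑ c ∈ T, x c) =
      ∑ σ : Equiv.Perm ι, g (fun i => x (σ i)) := by
  have expand : ∀ T : Finset ι, g (fun _ => ∑ c ∈ T, x c) =
      ∑ r : ι → ι, if ∀ i, r i ∈ T then g (fun i => x (r i)) else 0 := by
    intro T
    rw [g.map_sum_finset (fun _ c => x c) fun _ => T, ← Finset.sum_filter]
    refine Finset.sum_congr ?_ fun _ _ => rfl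
    ext r
    simp [Fintype.mem_piFinset]
  -- Inclusion-exclusion: with `U` the image of `r`, this is the total coefficient of `g (x ∘ r)`,
  -- so only surjective `r` survive.
  have signs : ∀ U : Finset ι, (∑ T : Finset ι, if U ⊆ T then (-1 : ℝ) ^ (Tᶜ).card else 0) =
      if U = Finset.univ then 1 else 0 := by
    intro U
    have h := Finset.sum_powerset_neg_one_pow_card (x := Uᶜ)
    have h' : (∑ T ∈ (Uᶜ).powerset, (-1 : ℝ) ^ T.card) = if Uᶜ = ∅ then 1 else 0 := by
      exact_mod_cast h
    rw [show (if U = Finset.univ then (1 : ℝ) else 0) = if Uᶜ = ∅ then 1 else 0 by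
      simp only [Finset.compl_eq_empty_iff], ← h', ← Finset.sum_filter]
    refine Finset.sum_nbij' (fun T => Tᶜ) (fun T => Tᶜ) ?_ ?_ ?_ ?_ ?_ <;>
      simp +contextual [Finset.subset_compl_comm]
  calc ∑ T : Finset ι, (-1 : ℝ) ^ (Tᶜ).card • g (fun _ => ∑ c ∈ T, x c)
      = ∑ r : ι → ι, (∑ T : Finset ι,
          if Finset.univ.image r ⊆ T then (-1 : ℝ) ^ (Tᶜ).card else 0) • g (fun i => x (r i)) := by
        simp_rw [expand, Finset.smul_sum, Finset.sum_smul]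
        rw [Finset.sum_comm]
        refine Finset.sum_congr rfl fun r _ => Finset.sum_congr rfl fun T _ => ?_
        simp [Finset.image_subset_iff, ite_smul]
    _ = ∑ r : ι → ι, if Function.Bijective r then g (fun i => x (r i)) else 0 := by
        refine Finset.sum_congr rfl fun r _ => ?_
        have : Finset.univ.image r = Finset.univ ↔ Function.Bijective r := by
          rw [← Finite.surjective_iff_bijective]
          simp [Finset.ext_iff, Function.Surjective]
        rw [signs]
        simp [this]
    _ = ∑ σ : Equiv.Perm ι, g (fun i => x (σ i)) := by
        rw [← Finset.sum_filter]
        refine (Finset.sum_bij' (fun (σ : Equiv.Perm ι) _ => (σ : ι → ι))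
          (fun r hr => Equiv.ofBijective r (Finset.mem_filter.mp hr).2) ?_ ?_ ?_ ?_ ?_).symm
        · intro σ _
          simp
        · simp
        · intro σ _
          ext
          rfl
        · intro r _
          rfl
        · intro σ _
          rfl

/-- A symmetric multilinear map is determined by its diagonal. -/
theorem eq_zero_of_diagonal_eq_zero {V W : Type*} [AddCommGroup V] [Module ℝ V] [AddCommGroup W]
    [Module ℝ W] {n : ℕ} (g : MultilinearMap ℝ (fun _ : Fin n => V) W)
    (hg : ∀ (σ : Equiv.Perm (Fin n)) (v : Fin n → V), g (fun i => v (σ i)) = g v)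
    (h : ∀ v, g (fun _ => v) = 0) : g = 0 := by
  ext v
  have key := sum_diagonal_eq_sum_perm g v
  simp only [h, smul_zero, Finset.sum_const_zero, hg, Finset.sum_const, Finset.card_univ,
    Fintype.card_perm, Fintype.card_fin] at key
  rw [← Nat.cast_smul_eq_nsmul ℝ] at key
  have hn : ((n.factorial : ℕ) : ℝ) ≠ 0 := by exact_mod_cast n.factorial_ne_zero
  exact (smul_eq_zero.mp key.symm).resolve_left hn

/-! ### Powers of linear forms on symmetric powers -/

@[simp]
theorem symEval_tprod {V : Type} [AddCommMonoid V] [Module ℝ V] {n : ℕ} (l : V →ₗ[ℝ] ℝ)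
    (v : Fin n → V) : symEval n l (SymmetricPower.tprod ℝ v) = ∏ i, l (v i) := by
  simp [symEval]

theorem symEval_smul {V : Type} [AddCommMonoid V] [Module ℝ V] {n : ℕ} (c : ℝ) (l : V →ₗ[ℝ] ℝ) :
    symEval n (c • l) = c ^ n • symEval n l :=
  sym_hom_ext fun v => by simp [Finset.prod_mul_distrib]

/-- Finitely many powers of linear forms determine the elements of a symmetric power. -/
theorem exists_symEval_resolution (V : Type) [AddCommGroup V] [Module ℝ V] [FiniteDimensional ℝ V]
    (n : ℕ) : ∃ (ι : Type) (_ : Fintype ι) (l : ι → V →ₗ[ℝ] ℝ) (w : ι → Sym[ℝ]^n V),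
      ∀ s, s = ∑ a, symEval n (l a) s • w a := by
  classical
  let b := Module.finBasis ℝ V
  have hn : ((n.factorial : ℕ) : ℝ) ≠ 0 := by exact_mod_cast n.factorial_ne_zero
  -- Polarization in the dual space: a product of `n` coordinate forms is a signed combination of
  -- `n`-th powers of their partial sums. The factor `1/n!` compensates for the sum over
  -- permutations, each of which reproduces the same symmetric tensor.
  refine ⟨(Fin n → Fin (Module.finrank ℝ V)) × Finset (Fin n), inferInstance,
    fun a => ∑ k ∈ a.2, b.coord (a.1 k),
    fun a => ((n.factorial : ℝ)⁻¹ * (-1) ^ (a.2ᶜ).card) •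
      SymmetricPower.tprod ℝ fun k => b (a.1 k), fun s => ?_⟩
  suffices h : LinearMap.id = ∑ a : (Fin n → Fin (Module.finrank ℝ V)) × Finset (Fin n),
      (symEval n (∑ k ∈ a.2, b.coord (a.1 k))).smulRight
        (((n.factorial : ℝ)⁻¹ * (-1) ^ (a.2ᶜ).card) •
          SymmetricPower.tprod ℝ fun k => b (a.1 k)) by
    simpa using LinearMap.congr_fun h s
  refine sym_hom_ext fun v => ?_
  have perm : ∀ i : Fin n → Fin (Module.finrank ℝ V),
      ∑ T : Finset (Fin n), (-1 : ℝ) ^ (Tᶜ).card * ∏ k, (∑ c ∈ T, b.coord (i c)) (v k) =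
        ∑ σ : Equiv.Perm (Fin n), ∏ k, b.coord (i k) (v (σ k)) := by
    intro i
    let g : MultilinearMap ℝ (fun _ : Fin n => V →ₗ[ℝ] ℝ) ℝ :=
      (MultilinearMap.mkPiAlgebra ℝ (Fin n) ℝ).compLinearMap fun k => LinearMap.applyₗ (v k)
    have := sum_diagonal_eq_sum_perm g fun c => b.coord (i c)
    simp only [g, MultilinearMap.compLinearMap_apply, MultilinearMap.mkPiAlgebra_apply,
      LinearMap.applyₗ_apply_apply, smul_eq_mul] at this
    rw [this, ← Equiv.sum_comp (Equiv.inv (Equiv.Perm (Fin n)))]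
    refine Finset.sum_congr rfl fun σ _ => ?_
    rw [← Equiv.prod_comp σ]
    simp
  have recon : ∀ σ : Equiv.Perm (Fin n),
      ∑ i : Fin n → Fin (Module.finrank ℝ V), (∏ k, b.coord (i k) (v (σ k))) •
        (SymmetricPower.tprod ℝ fun k => b (i k)) = SymmetricPower.tprod ℝ v := by
    intro σ
    rw [← SymmetricPower.tprod_equiv σ v]
    conv_rhs => enter [2, k]; rw [← b.sum_repr (v (σ k))]
    rw [MultilinearMap.map_sum]
    refine Finset.sum_congr rfl fun i _ => ?_
    rw [MultilinearMap.map_smul_univ]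
    rfl
  simp only [LinearMap.id_coe, id_eq, LinearMap.coe_sum, Finset.sum_apply,
    LinearMap.smulRight_apply, symEval_tprod, Fintype.sum_prod_type]
  have : ∀ i : Fin n → Fin (Module.finrank ℝ V), ∑ T : Finset (Fin n),
      (∏ k, (∑ c ∈ T, b.coord (i c)) (v k)) • (((n.factorial : ℝ)⁻¹ * (-1) ^ (Tᶜ).card) •
          SymmetricPower.tprod ℝ fun k => b (i k)) =
      (n.factorial : ℝ)⁻¹ • ∑ σ : Equiv.Perm (Fin n), (∏ k, b.coord (i k) (v (σ k))) •
        SymmetricPower.tprod ℝ fun k => b (i k) := by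
    intro i
    rw [← Finset.sum_smul, ← perm, Finset.sum_smul, Finset.smul_sum]
    refine Finset.sum_congr rfl fun T _ => ?_
    simp only [smul_smul]
    congr 1
    ring
  simp only [LinearMap.coe_sum, Finset.sum_apply] at this
  simp only [this]
  rw [← Finset.smul_sum, Finset.sum_comm]
  simp only [recon, Finset.sum_const, Finset.card_univ, Fintype.card_perm, Fintype.card_fin]
  rw [← Nat.cast_smul_eq_nsmul ℝ, smul_smul, inv_mul_cancel₀ hn, one_smul]

/-! ### Contraction with families of linear forms -/

/-- The contraction of `⨂_j sym^{κ j} (M* ⊗ sym^j M)` with linear forms on the factors. -/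
def prodEval {d : ℕ} (l : ∀ j, Factor d j →ₗ[ℝ] ℝ) (κ : NatComposition) :
    (⨂[ℝ] j : κ.support, Sym[ℝ]^(κ j) (Factor d j)) →ₗ[ℝ] ℝ :=
  PiTensorProduct.lift ((MultilinearMap.mkPiAlgebra ℝ κ.support ℝ).compLinearMap
    fun j : κ.support => symEval (κ j) (l j))

@[simp]
theorem prodEval_tprod {d : ℕ} (l : ∀ j, Factor d j →ₗ[ℝ] ℝ) (κ : NatComposition)
    (s : ∀ j : κ.support, Sym[ℝ]^(κ j) (Factor d j)) :
    prodEval l κ (PiTensorProduct.tprod ℝ s) = ∏ j : κ.support, symEval (κ j) (l j) (s j) := by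
  simp [prodEval]

/-- The contraction of `Sym_κ` with linear forms on the factors. -/
def contract {d : ℕ} (l : ∀ j, Factor d j →ₗ[ℝ] ℝ) (κ : NatComposition) :
    SymSpace d κ →ₗ[ℝ] Space d :=
  (TensorProduct.rid ℝ (Space d)).toLinearMap ∘ₗ LinearMap.lTensor (Space d) (prodEval l κ)

@[simp]
theorem contract_tmul {d : ℕ} (l : ∀ j, Factor d j →ₗ[ℝ] ℝ) (κ : NatComposition) (x : Space d)
    (s : ⨂[ℝ] j : κ.support, Sym[ℝ]^(κ j) (Factor d j)) :
    contract l κ (x ⊗ₜ s) = prodEval l κ s • x := by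
  simp [contract]

theorem symSpaceEval_eq_contract {d : ℕ} (f : VectorField d) (κ : NatComposition) :
    symSpaceEval f κ = contract (factorEval f) κ := rfl

theorem prodEval_congr {d : ℕ} {l l' : ∀ j, Factor d j →ₗ[ℝ] ℝ} {κ : NatComposition}
    (h : ∀ j ∈ κ.support, l j = l' j) : prodEval l κ = prodEval l' κ := by
  unfold prodEval
  congr 2
  funext j
  rw [h j j.2]

theorem contract_congr {d : ℕ} {l l' : ∀ j, Factor d j →ₗ[ℝ] ℝ} {κ : NatComposition}
    (h : ∀ j ∈ κ.support, l j = l' j) : contract l κ = contract l' κ := by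
  unfold contract
  rw [prodEval_congr h]

theorem symSpace_hom_ext {d : ℕ} {κ : NatComposition} {W : Type} [AddCommMonoid W] [Module ℝ W]
    {p q : SymSpace d κ →ₗ[ℝ] W}
    (h : ∀ x s, p (x ⊗ₜ PiTensorProduct.tprod ℝ s) = q (x ⊗ₜ PiTensorProduct.tprod ℝ s)) :
    p = q := by
  refine TensorProduct.ext (LinearMap.ext fun x => PiTensorProduct.ext ?_)
  ext s
  exact h x s

/-- Used twice: with free `c j` the monomial tells compositions apart, and with `c j = c * t ^ j` it
gives the weight under scalings. -/
theorem contract_smul {d : ℕ} (c : ℕ → ℝ) (l : ∀ j, Factor d j →ₗ[ℝ] ℝ) (κ : NatComposition) :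
    contract (fun j => c j • l j) κ = (∏ j ∈ κ.support, c j ^ κ j) • contract l κ := by
  refine symSpace_hom_ext fun x s => ?_
  simp only [contract_tmul, prodEval_tprod, symEval_smul, LinearMap.smul_apply, smul_eq_mul,
    Finset.prod_mul_distrib, smul_smul]
  rw [Finset.prod_coe_sort κ.support fun j => c j ^ κ j]

instance {V : Type} [AddCommGroup V] [Module ℝ V] [FiniteDimensional ℝ V] (n : ℕ) :
    FiniteDimensional ℝ (Sym[ℝ]^n V) := by
  obtain ⟨ι, _, l, w, h⟩ := exists_symEval_resolution V n
  refine ⟨(Submodule.fg_def.mpr ⟨Set.range w, Set.finite_range w, ?_⟩)⟩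
  refine Submodule.eq_top_iff'.mpr fun s => ?_
  rw [h s]
  exact Submodule.sum_mem _ fun a _ =>
    Submodule.smul_mem _ _ (Submodule.subset_span (Set.mem_range_self a))

/-- Finitely many contractions determine the elements of `Sym_κ`. -/
theorem exists_contract_resolution (d : ℕ) (κ : NatComposition) :
    ∃ (ι : Type) (_ : Fintype ι) (l : ι → ∀ j, Factor d j →ₗ[ℝ] ℝ)
      (u : ι → ⨂[ℝ] j : κ.support, Sym[ℝ]^(κ j) (Factor d j)),
      ∀ S : SymSpace d κ, S = ∑ a, contract (l a) κ S ⊗ₜ u a := by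
  classical
  choose ι _ l w h using fun j => exists_symEval_resolution (Factor d j) (κ j)
  -- The value `0` off the support is immaterial: `contract` only sees the forms with index in
  -- `κ.support`.
  refine ⟨∀ j : κ.support, ι j, inferInstance,
    fun a j => if hj : j ∈ κ.support then l j (a ⟨j, hj⟩) else 0,
    fun a => PiTensorProduct.tprod ℝ fun j : κ.support => w j (a j), fun S => ?_⟩
  suffices key : LinearMap.id = ∑ a : ∀ j : κ.support, ι j,
      (TensorProduct.mk ℝ _ _).flip (PiTensorProduct.tprod ℝ fun j : κ.support => w j (a j)) ∘ₗ
        contract (fun j => if hj : j ∈ κ.support then l j (a ⟨j, hj⟩) else 0) κ by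
    simpa using LinearMap.congr_fun key S
  refine symSpace_hom_ext fun x s => ?_
  simp only [LinearMap.id_coe, id_eq, LinearMap.coe_sum, Finset.sum_apply, LinearMap.comp_apply,
    contract_tmul, prodEval_tprod, LinearMap.flip_apply, TensorProduct.mk_apply,
    Finset.coe_mem, dite_true, TensorProduct.smul_tmul]
  rw [← TensorProduct.tmul_sum]
  congr 1
  conv_lhs => enter [2, j]; rw [h j (s j)]
  rw [MultilinearMap.map_sum]
  exact Finset.sum_congr rfl fun a _ => MultilinearMap.map_smul_univ _ _ _

theorem eq_zero_of_contract_eq_zero {d : ℕ} {κ : NatComposition} (S : SymSpace d κ)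
    (h : ∀ l, contract l κ S = 0) : S = 0 := by
  obtain ⟨ι, _, l, u, hu⟩ := exists_contract_resolution d κ
  rw [hu S]
  simp [h]

instance (d : ℕ) (κ : NatComposition) : FiniteDimensional ℝ (SymSpace d κ) := by
  obtain ⟨ι, _, l, u, hu⟩ := exists_contract_resolution d κ
  refine Module.Finite.of_injective (LinearMap.pi fun a => contract (l a) κ) ?_
  intro S T hST
  rw [hu S, hu T]
  exact Finset.sum_congr rfl fun a _ => congrArg (· ⊗ₜ u a) (congrFun hST a)

/-! ### Equivariance of contractions -/

theorem symEval_symMap {V : Type} [AddCommMonoid V] [Module ℝ V] {n : ℕ} (l : V →ₗ[ℝ] ℝ)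
    (p : V →ₗ[ℝ] V) (s : Sym[ℝ]^n V) : symEval n l (symMap n p s) = symEval n (l ∘ₗ p) s := by
  have : symEval n l ∘ₗ symMap n p = symEval n (l ∘ₗ p) := sym_hom_ext fun v => by simp
  exact LinearMap.congr_fun this s

theorem contract_symSpaceRep {d : ℕ} {H : Subgroup (Space d ≃ₗ[ℝ] Space d)} (A : H)
    {l l' : ∀ j, Factor d j →ₗ[ℝ] ℝ} (h : ∀ j, l' j ∘ₗ factorRep H j A = l j)
    (κ : NatComposition) (S : SymSpace d κ) :
    contract l' κ (symSpaceRep H κ A S) = A.1 (contract l κ S) := by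
  have : contract l' κ ∘ₗ symSpaceRep H κ A = A.1.toLinearMap ∘ₗ contract l κ := by
    refine symSpace_hom_ext fun x s => ?_
    have hp : productRep H κ A (PiTensorProduct.tprod ℝ s) =
        PiTensorProduct.tprod ℝ fun j : κ.support => symMap (κ j) (factorRep H j A) (s j) :=
      PiTensorProduct.map_tprod _ _
    have hx : symSpaceRep H κ A (x ⊗ₜ PiTensorProduct.tprod ℝ s) =
        A.1 x ⊗ₜ productRep H κ A (PiTensorProduct.tprod ℝ s) := rfl
    simp [hx, hp, symEval_symMap, h]
  exact LinearMap.congr_fun this S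

/-! ### Contractions as polynomial functions of the jet -/

/-- The function `f ↦ ⟨v, f^(j)(0)⟩`. -/
def factorFun (d j : ℕ) : Factor d j →ₗ[ℝ] (VectorField d → ℝ) :=
  LinearMap.pi fun f => factorEval f j

/-- The linear functions of the `j`-th derivative at the origin. -/
def jetForms (d j : ℕ) : Submodule ℝ (VectorField d → ℝ) := LinearMap.range (factorFun d j)

/-- The contraction with the jet of a vector field as a function of the vector field. -/
def prodFun (d : ℕ) (κ : NatComposition) :
    (⨂[ℝ] j : κ.support, Sym[ℝ]^(κ j) (Factor d j)) →ₗ[ℝ] (VectorField d → ℝ) :=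
  LinearMap.pi fun f => prodEval (factorEval f) κ

/-- The contraction of `Sym_κ` with the jet of a vector field as a function of the vector field. -/
def pairing (d : ℕ) (κ : NatComposition) : SymSpace d κ →ₗ[ℝ] (VectorField d → Space d) :=
  LinearMap.pi fun f => symSpaceEval f κ

/-- Both sides are spanned by products of `n` linear forms. Working with submodules of the algebra
of functions lets products of jet forms be regrouped by commutativity, without handling tensors. -/
theorem range_symEval (d j n : ℕ) :
    LinearMap.range (LinearMap.pi fun f : VectorField d => symEval n (factorEval f j)) =
      jetForms d j ^ n := by
  apply le_antisymm
  · rw [LinearMap.range_eq_map, ← SymmetricPower.span_tprod_eq_top, Submodule.map_span_le]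
    rintro _ ⟨v, rfl⟩
    rw [Submodule.pow_eq_span_pow_set]
    refine Submodule.subset_span (Set.mem_pow.mpr
      ⟨fun i => ⟨factorFun d j (v i), v i, rfl⟩, ?_⟩)
    funext f
    simp [List.prod_ofFn, factorFun]
  · rw [Submodule.pow_eq_span_pow_set, Submodule.span_le]
    intro a ha
    obtain ⟨g, rfl⟩ := Set.mem_pow.mp ha
    choose v hv using fun i => (g i).2
    refine ⟨SymmetricPower.tprod ℝ v, ?_⟩
    funext f
    simp [List.prod_ofFn, ← hv, factorFun]

-- As in `range_symEval`, checked on spanning sets: pure tensors on one side, products of elements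
-- on the other.
open scoped Pointwise in
theorem range_prodFun (d : ℕ) (κ : NatComposition) :
    LinearMap.range (prodFun d κ) = ∏ j ∈ κ.support, jetForms d j ^ κ j := by
  have hspan : ∏ j ∈ κ.support, jetForms d j ^ κ j = Submodule.span ℝ
      (∏ j : κ.support, ((jetForms d j ^ κ j : Submodule ℝ (VectorField d → ℝ)) : Set _)) := by
    rw [← Submodule.prod_span, ← Finset.prod_coe_sort]
    simp
  rw [hspan]
  apply le_antisymm
  · rw [LinearMap.range_eq_map, ← PiTensorProduct.span_tprod_eq_top, Submodule.map_span_le]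
    rintro _ ⟨s, rfl⟩
    refine Submodule.subset_span (Set.mem_finsetProd _ _ _ |>.mpr
      ⟨fun j f => symEval (κ j) (factorEval f j) (s j), fun {j} _ => ?_, ?_⟩)
    · rw [← range_symEval]
      exact ⟨s j, rfl⟩
    · funext f
      simp [prodFun]
  · rw [Submodule.span_le]
    intro a ha
    obtain ⟨g, hg, rfl⟩ := (Set.mem_finsetProd _ _ _).mp ha
    simp only [Finset.mem_univ, SetLike.mem_coe, ← range_symEval, forall_true_left] at hg
    choose s hs using fun j => @hg j
    refine ⟨PiTensorProduct.tprod ℝ s, ?_⟩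
    funext f
    simp [prodFun, ← hs]

/-! ### Vector fields with prescribed jets -/

@[simp]
theorem factorEval_tmul {d : ℕ} (f : VectorField d) (j : ℕ) (ξ : Module.Dual ℝ (Space d))
    (v : Fin j → Space d) :
    factorEval f j (ξ ⊗ₜ SymmetricPower.tprod ℝ v) = ξ (iteratedFDeriv ℝ j f 0 v) := by
  simp [factorEval, taylorCoeff]

theorem factor_hom_ext {d j : ℕ} {W : Type} [AddCommMonoid W] [Module ℝ W]
    {p q : Factor d j →ₗ[ℝ] W}
    (h : ∀ ξ v, p (ξ ⊗ₜ SymmetricPower.tprod ℝ v) = q (ξ ⊗ₜ SymmetricPower.tprod ℝ v)) : p = q :=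
  TensorProduct.ext (LinearMap.ext fun ξ => sym_hom_ext fun v => h ξ v)

theorem sum_coord_smul {d : ℕ} (x : Space d) :
    ∑ k, x k • EuclideanSpace.basisFun (Fin d) ℝ k = x := by
  simpa using (EuclideanSpace.basisFun (Fin d) ℝ).sum_repr x

theorem multilinear_eq_sum {d j : ℕ} {W : Type} [AddCommGroup W] [Module ℝ W]
    (q : MultilinearMap ℝ (fun _ : Fin j => Space d) W) (v : Fin j → Space d) :
    q v = ∑ i : Fin j → Fin d, (∏ l, v l (i l)) •
      q fun l => EuclideanSpace.basisFun (Fin d) ℝ (i l) := by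
  conv_lhs => enter [2, l]; rw [← sum_coord_smul (v l)]
  rw [MultilinearMap.map_sum]
  exact Finset.sum_congr rfl fun i _ => MultilinearMap.map_smul_univ _ _ _

theorem multilinear_continuous {d j : ℕ}
    (q : MultilinearMap ℝ (fun _ : Fin j => Space d) (Space d)) : Continuous q := by
  rw [funext (multilinear_eq_sum q)]
  fun_prop

/-- The homogeneous polynomial vector field given by a multilinear map. -/
def homogeneousField {d j : ℕ}
    (q : ContinuousMultilinearMap ℝ (fun _ : Fin j => Space d) (Space d)) : VectorField d :=
  ⟨fun x => q fun _ => x, by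
    have : ContDiff ℝ ∞ fun (x : Space d) (_ : Fin j) => x := contDiff_pi.mpr fun _ => contDiff_id
    exact q.contDiff.comp this⟩

/-- The formal multilinear series with a single nonzero term. -/
def singleSeries {d j : ℕ}
    (q : ContinuousMultilinearMap ℝ (fun _ : Fin j => Space d) (Space d)) :
    FormalMultilinearSeries ℝ (Space d) (Space d) :=
  fun n => if h : j = n then h ▸ q else 0

theorem singleSeries_self {d j : ℕ}
    (q : ContinuousMultilinearMap ℝ (fun _ : Fin j => Space d) (Space d)) :
    singleSeries q j = q := by
  simp [singleSeries]

theorem singleSeries_of_ne {d j n : ℕ}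
    (q : ContinuousMultilinearMap ℝ (fun _ : Fin j => Space d) (Space d)) (h : n ≠ j) :
    singleSeries q n = 0 := by
  simp [singleSeries, h.symm]

/-- The one-term series represents the field on all of `ℝ^d`, and the `n`-th derivative at the
centre of a power series is the sum of its `n`-th coefficient over all permutations of the
arguments. -/
theorem iteratedFDeriv_homogeneousField {d j : ℕ}
    (q : ContinuousMultilinearMap ℝ (fun _ : Fin j => Space d) (Space d)) (n : ℕ)
    (v : Fin n → Space d) :
    iteratedFDeriv ℝ n (homogeneousField q) 0 v =
      ∑ σ : Equiv.Perm (Fin n), singleSeries q n fun i => v (σ i) := by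
  refine HasFPowerSeriesOnBall.iteratedFDeriv_eq_sum_of_completeSpace (r := ⊤)
    ⟨?_, by simp, fun {y} _ => ?_⟩ v
  · rw [FormalMultilinearSeries.radius_eq_top_of_forall_image_add_eq_zero _ (j + 1)]
    intro m
    exact singleSeries_of_ne q (by omega)
  · have := hasSum_single (f := fun n : ℕ =>
      singleSeries q n fun _ : Fin n => y) j fun n hn => by
        rw [singleSeries_of_ne q hn]
        rfl
    rw [singleSeries_self] at this
    simpa [homogeneousField] using this

theorem iteratedFDeriv_homogeneousField_of_ne {d j : ℕ}
    (q : ContinuousMultilinearMap ℝ (fun _ : Fin j => Space d) (Space d)) {n : ℕ} (h : n ≠ j) :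
    iteratedFDeriv ℝ n (homogeneousField q) 0 = 0 := by
  ext1 v
  rw [iteratedFDeriv_homogeneousField, singleSeries_of_ne q h]
  simp

theorem iteratedFDeriv_homogeneousField_self {d j : ℕ}
    (q : ContinuousMultilinearMap ℝ (fun _ : Fin j => Space d) (Space d))
    (hq : ∀ (σ : Equiv.Perm (Fin j)) (v : Fin j → Space d), q (fun i => v (σ i)) = q v) :
    iteratedFDeriv ℝ j (homogeneousField q) 0 = (j.factorial : ℝ) • q := by
  ext1 v
  rw [iteratedFDeriv_homogeneousField, singleSeries_self]
  simp [hq, Finset.sum_const, Finset.card_univ, Fintype.card_perm, ← Nat.cast_smul_eq_nsmul ℝ]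

theorem iteratedFDeriv_sum_field {d : ℕ} {ι : Type} (s : Finset ι) (f : ι → VectorField d)
    (n : ℕ) (x : Space d) :
    iteratedFDeriv ℝ n (∑ a ∈ s, f a : VectorField d) x = ∑ a ∈ s, iteratedFDeriv ℝ n (f a) x := by
  have h : ∀ g : VectorField d, iteratedFDeriv ℝ n g x = VectorField.iteratedDerivative n g x :=
    fun _ => rfl
  simp only [h, map_sum, ContinuousMap.coe_sum, Finset.sum_apply]

theorem iteratedFDeriv_smul_field {d : ℕ} (c : ℝ) (f : VectorField d) (n : ℕ) (x : Space d) :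
    iteratedFDeriv ℝ n (c • f : VectorField d) x = c • iteratedFDeriv ℝ n f x :=
  congrArg (· x) (map_smul (VectorField.iteratedDerivative n) c f)

theorem iteratedFDeriv_sub_field {d : ℕ} (f g : VectorField d) (n : ℕ) (x : Space d) :
    iteratedFDeriv ℝ n (f - g : VectorField d) x =
      iteratedFDeriv ℝ n f x - iteratedFDeriv ℝ n g x :=
  congrArg (· x) (map_sub (VectorField.iteratedDerivative n) f g)

theorem sum_field_apply {d : ℕ} {ι : Type} (s : Finset ι) (f : ι → VectorField d) (x : Space d) :
    (∑ a ∈ s, f a : VectorField d) x = ∑ a ∈ s, f a x := by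
  have h : ∀ g : VectorField d, g x = (LinearMap.proj x ∘ₗ (smoothMaps d).subtype) g := fun _ => rfl
  rw [h]
  exact map_sum ((LinearMap.proj x : (Space d → Space d) →ₗ[ℝ] Space d) ∘ₗ
    (smoothMaps d).subtype) f s

/-- The derivatives at the origin of a polynomial vector field. -/
theorem iteratedFDeriv_sum_homogeneousField {d : ℕ}
    (q : ∀ j, ContinuousMultilinearMap ℝ (fun _ : Fin j => Space d) (Space d))
    (hq : ∀ j (σ : Equiv.Perm (Fin j)) (v : Fin j → Space d), q j (fun i => v (σ i)) = q j v)
    (s : Finset ℕ) (n : ℕ) :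
    iteratedFDeriv ℝ n
      (∑ j ∈ s, (j.factorial : ℝ)⁻¹ • homogeneousField (q j) : VectorField d) 0 =
        if n ∈ s then q n else 0 := by
  have hn : ((n.factorial : ℕ) : ℝ) ≠ 0 := by exact_mod_cast n.factorial_ne_zero
  rw [iteratedFDeriv_sum_field]
  simp only [iteratedFDeriv_smul_field]
  split_ifs with h
  · rw [Finset.sum_eq_single_of_mem n h fun j _ hj => by
      rw [iteratedFDeriv_homogeneousField_of_ne _ hj.symm, smul_zero],
      iteratedFDeriv_homogeneousField_self _ (hq n), smul_smul, inv_mul_cancel₀ hn, one_smul]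
  · refine Finset.sum_eq_zero fun j hj => ?_
    rw [iteratedFDeriv_homogeneousField_of_ne _ (by rintro rfl; exact h hj), smul_zero]

/-- Every family of linear forms on the factors is realized by a vector field, up to any finite
order. -/
theorem exists_factorEval_eq {d : ℕ} (l : ∀ j, Factor d j →ₗ[ℝ] ℝ) (s : Finset ℕ) :
    ∃ f : VectorField d, ∀ j ∈ s, factorEval f j = l j := by
  let e := EuclideanSpace.basisFun (Fin d) ℝ
  -- Duality: a linear form on `M* ⊗ sym^j M` is a linear map `sym^j M → M`, whose `k`-th component
  -- is the form evaluated on the `k`-th coordinate covector.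
  let q : ∀ j, MultilinearMap ℝ (fun _ : Fin j => Space d) (Space d) := fun j =>
    ∑ k, (((l j ∘ₗ TensorProduct.mk ℝ _ _ (e.toBasis.coord k)).smulRight (e k)).compMultilinearMap
      (SymmetricPower.tprod ℝ))
  have hq : ∀ j v, q j v = ∑ k, l j (e.toBasis.coord k ⊗ₜ SymmetricPower.tprod ℝ v) • e k := by
    intro j v
    simp [q]
  let Q : ∀ j, ContinuousMultilinearMap ℝ (fun _ : Fin j => Space d) (Space d) := fun j =>
    ⟨q j, multilinear_continuous (q j)⟩
  have hsym : ∀ j (σ : Equiv.Perm (Fin j)) (v : Fin j → Space d),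
      Q j (fun i => v (σ i)) = Q j v := by
    intro j σ v
    change q j _ = q j _
    rw [hq, hq, SymmetricPower.tprod_equiv]
  refine ⟨∑ j ∈ s, (j.factorial : ℝ)⁻¹ • homogeneousField (Q j),
    fun j hj => factor_hom_ext fun ξ v => ?_⟩
  rw [factorEval_tmul, iteratedFDeriv_sum_homogeneousField Q hsym s j, if_pos hj]
  change ξ (q j v) = _
  have hξ : ∑ k, ξ (e k) • e.toBasis.coord k = ξ := by
    refine e.toBasis.ext fun i => ?_
    simp
  rw [hq, map_sum]
  conv_rhs => rw [← hξ]
  simp only [TensorProduct.sum_tmul, map_sum, map_smul, ← TensorProduct.smul_tmul', smul_eq_mul]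
  exact Finset.sum_congr rfl fun k _ => mul_comm _ _

/-- The Taylor polynomial at the origin, up to order `m - 1`. -/
def taylorField {d : ℕ} (m : ℕ) (f : VectorField d) : VectorField d :=
  ∑ j ∈ Finset.range m, (j.factorial : ℝ)⁻¹ • homogeneousField (iteratedFDeriv ℝ j f 0)

theorem iteratedFDeriv_taylorField {d : ℕ} {m n : ℕ} (f : VectorField d) (h : n < m) :
    iteratedFDeriv ℝ n (taylorField m f) 0 = iteratedFDeriv ℝ n f 0 := by
  rw [taylorField, iteratedFDeriv_sum_homogeneousField (fun j => iteratedFDeriv ℝ j f 0)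
    (fun j => iteratedFDeriv_perm f.contDiff j 0), if_pos (Finset.mem_range.mpr h)]

/-- A monomial vector field. -/
def monomialField {d j : ℕ} (i : Fin j → Fin d) (k : Fin d) : VectorField d :=
  ⟨fun x => (∏ l, x (i l)) • EuclideanSpace.basisFun (Fin d) ℝ k, by
    have : ContDiff ℝ ∞ fun x : Space d => ∏ l, x (i l) :=
      contDiff_prod fun l _ => by fun_prop
    exact this.smul contDiff_const⟩

/-- The Taylor polynomial as a combination of monomials. -/
theorem taylorField_eq_sum {d : ℕ} (m : ℕ) (f : VectorField d) :
    taylorField m f = ∑ a : (Σ j : Fin m, (Fin j → Fin d) × Fin d),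
      factorEval f a.1 ((EuclideanSpace.basisFun (Fin d) ℝ).toBasis.coord a.2.2 ⊗ₜ
        SymmetricPower.tprod ℝ fun l => EuclideanSpace.basisFun (Fin d) ℝ (a.2.1 l)) •
      ((a.1 : ℕ).factorial : ℝ)⁻¹ • monomialField a.2.1 a.2.2 := by
  rw [taylorField, Finset.sum_range, Fintype.sum_sigma]
  refine Finset.sum_congr rfl fun j _ => Subtype.ext (funext fun x => ?_)
  change ((j : ℕ).factorial : ℝ)⁻¹ • (iteratedFDeriv ℝ j f 0 fun _ => x) = _
  refine Eq.trans ?_ (sum_field_apply _ _ _).symm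
  have := multilinear_eq_sum (iteratedFDeriv ℝ j f 0).toMultilinearMap fun _ => x
  refine (congrArg _ this).trans ?_
  rw [Fintype.sum_prod_type, Finset.smul_sum]
  refine Finset.sum_congr rfl fun i _ => ?_
  conv_lhs => rw [← sum_coord_smul ((iteratedFDeriv ℝ j f 0).toMultilinearMap _)]
  rw [Finset.smul_sum, Finset.smul_sum]
  refine Finset.sum_congr rfl fun k _ => ?_
  rw [factorEval_tmul]
  have hx : ∀ a b : ℝ, (a • b • monomialField i k : VectorField d) x =
      a • b • (∏ l, x (i l)) • EuclideanSpace.basisFun (Fin d) ℝ k := fun _ _ => rfl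
  rw [hx]
  simp only [smul_smul]
  congr 1
  simp
  ring

/-! ### The topology on vector fields and dilations -/

/-- A map into the space of vector fields is continuous if all derivatives are jointly continuous in
the parameter and the point. -/
theorem continuous_field_of_uncurry {d : ℕ} {Y : Type} [TopologicalSpace Y] {F : Y → VectorField d}
    (h : ∀ n : ℕ, Continuous fun p : Y × Space d => iteratedFDeriv ℝ n (F p.1) p.2) :
    Continuous F := by
  refine continuous_iInf_rng.mpr fun n => continuous_induced_rng.mpr ?_
  exact ContinuousMap.continuous_of_continuous_uncurry _ (h n)

theorem continuous_iteratedDerivative {d : ℕ} (n : ℕ) :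
    Continuous (VectorField.iteratedDerivative (d := d) n) :=
  continuous_iInf_dom (i := n) continuous_induced_dom

/-- Evaluation is jointly continuous in the compact-open topology because `ℝ^d` is locally compact.
-/
theorem continuous_iteratedFDeriv_uncurry {d : ℕ} (n : ℕ) :
    Continuous fun p : VectorField d × Space d => iteratedFDeriv ℝ n p.1 p.2 := by
  have h := (continuous_iteratedDerivative (d := d) n).comp
    (continuous_fst (X := VectorField d) (Y := Space d))
  exact continuous_eval.comp (h.prodMk continuous_snd)

theorem continuous_eval_field {d : ℕ} (x : Space d) : Continuous fun f : VectorField d => f x := by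
  have h : Continuous fun f : VectorField d => iteratedFDeriv ℝ 0 f x fun _ => 0 :=
    (continuous_eval_const (F := ContinuousMultilinearMap ℝ (fun _ : Fin 0 => Space d) (Space d))
      (fun _ => (0 : Space d))).comp
      ((continuous_iteratedFDeriv_uncurry 0).comp (continuous_id.prodMk continuous_const))
  simpa using h

/-- Induction on the truncated difference `N - n`. For `n ≥ N` the bound is compactness of the unit
ball; below `N` the mean value inequality, starting from the zero at the origin, gains one power of
`‖x‖`. -/
theorem norm_iteratedFDeriv_le_of_flat {E F : Type} [NormedAddCommGroup E] [NormedSpace ℝ E]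
    [FiniteDimensional ℝ E] [NormedAddCommGroup F] [NormedSpace ℝ F] {h : E → F}
    (hh : ContDiff ℝ ∞ h) {N : ℕ} (hN : ∀ n < N, iteratedFDeriv ℝ n h 0 = 0) (n : ℕ) :
    ∃ C : ℝ, 0 ≤ C ∧ ∀ x, ‖x‖ ≤ 1 → ‖iteratedFDeriv ℝ n h x‖ ≤ C * ‖x‖ ^ (N - n) := by
  induction hk : N - n generalizing n with
  | zero =>
    have hc : Continuous (iteratedFDeriv ℝ n h) :=
      hh.continuous_iteratedFDeriv (by exact_mod_cast le_top)
    obtain ⟨C, hC⟩ := (isCompact_closedBall (0 : E) 1).exists_bound_of_continuousOn hc.continuousOn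
    refine ⟨max C 0, le_max_right _ _, fun x hx => ?_⟩
    rw [pow_zero, mul_one]
    exact (hC x (by simpa using hx)).trans (le_max_left _ _)
  | succ k ih =>
    obtain ⟨C, hC0, hC⟩ := ih (n + 1) (by omega)
    refine ⟨C, hC0, fun x hx => ?_⟩
    have hd : Differentiable ℝ (iteratedFDeriv ℝ n h) :=
      hh.differentiable_iteratedFDeriv (by exact_mod_cast WithTop.coe_lt_top _)
    have := (convex_closedBall (0 : E) ‖x‖).norm_image_sub_le_of_norm_fderiv_le
      (f := iteratedFDeriv ℝ n h) (C := C * ‖x‖ ^ k) (x := 0) (y := x) (fun y _ => hd y)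
      (fun y hy => by
        rw [norm_fderiv_iteratedFDeriv]
        have hy' : ‖y‖ ≤ ‖x‖ := by simpa using hy
        exact (hC y (hy'.trans hx)).trans (by gcongr)) (by simp) (by simp)
    rw [hN n (by omega), sub_zero, sub_zero, mul_assoc, ← pow_succ] at this
    exact this

/-- The vector field `x ↦ f (t x)`. -/
def dilate {d : ℕ} (t : ℝ) (f : VectorField d) : VectorField d :=
  ⟨fun x => f (t • x), f.contDiff.comp (contDiff_id.const_smul t)⟩

theorem iteratedFDeriv_dilate {d : ℕ} (t : ℝ) (f : VectorField d) (n : ℕ) (x : Space d) :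
    iteratedFDeriv ℝ n (dilate t f) x = t ^ n • iteratedFDeriv ℝ n f (t • x) :=
  congrFun (iteratedFDeriv_comp_const_smul t (f.contDiff.of_le (by exact_mod_cast le_top))) x

/-- Dilations of a vector field converge to the constant vector field. -/
theorem continuous_dilate {d : ℕ} (f : VectorField d) : Continuous fun t : ℝ => dilate t f := by
  refine continuous_field_of_uncurry fun n => ?_
  simp only [iteratedFDeriv_dilate]
  have hc : Continuous (iteratedFDeriv ℝ n f) :=
    f.contDiff.continuous_iteratedFDeriv (by exact_mod_cast le_top)
  fun_prop

/-- The `n`-th derivative is `t^(n-N)` times that of `f` at `t x`, which is `O((t‖x‖)^(N+1-n))` by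
flatness; a factor `t` is left over, uniformly on compact sets. -/
theorem tendsto_dilate_of_flat {d N : ℕ} {f : VectorField d}
    (hf : ∀ n < N + 1, iteratedFDeriv ℝ n f 0 = 0) :
    Tendsto (fun t : ℝ => (t ^ N)⁻¹ • dilate t f) (𝓝[>] 0) (𝓝 0) := by
  rw [nhds_iInf, tendsto_iInf]
  intro n
  rw [nhds_induced, tendsto_comap_iff, map_zero,
    ContinuousMap.tendsto_iff_forall_isCompact_tendstoUniformlyOn]
  intro K hK
  rw [Metric.tendstoUniformlyOn_iff]
  intro ε hε
  obtain ⟨R, hR1, hR⟩ : ∃ R : ℝ, 1 ≤ R ∧ ∀ x ∈ K, ‖x‖ ≤ R := by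
    obtain ⟨R, hR⟩ := hK.exists_bound_of_continuousOn (f := id) continuousOn_id
    exact ⟨max R 1, le_max_right _ _, fun x hx => (hR x hx).trans (le_max_left _ _)⟩
  obtain ⟨C, hC0, hC⟩ := norm_iteratedFDeriv_le_of_flat f.contDiff hf n
  have hlim : Tendsto (fun t : ℝ => C * R ^ (N + 1) * t) (𝓝[>] 0) (𝓝 0) := by
    have : Tendsto (fun t : ℝ => C * R ^ (N + 1) * t) (𝓝 0) (𝓝 (C * R ^ (N + 1) * 0)) :=
      (continuous_const.mul continuous_id).tendsto 0
    rw [mul_zero] at this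
    exact this.mono_left nhdsWithin_le_nhds
  have hR0 : 0 < R := by linarith
  -- The condition `t < 1/R` keeps `t x` in the unit ball, where the flatness estimate holds.
  filter_upwards [hlim.eventually (gt_mem_nhds hε), self_mem_nhdsWithin,
    mem_nhdsWithin_of_mem_nhds (gt_mem_nhds (inv_pos.mpr hR0))] with t ht ht0 htR x hx
  replace ht0 : 0 < t := ht0
  have htR' : t * R ≤ 1 := by
    have := mul_le_mul_of_nonneg_right (le_of_lt htR) hR0.le
    rwa [inv_mul_cancel₀ hR0.ne'] at this
  have ht1 : t ≤ 1 := by nlinarith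
  have hval : (⇑(VectorField.iteratedDerivative n ((t ^ N)⁻¹ • dilate t f)) x) =
      (t ^ N)⁻¹ • t ^ n • iteratedFDeriv ℝ n f (t • x) := by
    rw [← iteratedFDeriv_dilate, ← iteratedFDeriv_smul_field]
    rfl
  have htx : ‖t • x‖ = t * ‖x‖ := by rw [norm_smul, Real.norm_of_nonneg ht0.le]
  have hbound : ‖iteratedFDeriv ℝ n f (t • x)‖ ≤ C * (t * ‖x‖) ^ (N + 1 - n) := by
    rw [← htx]
    refine hC _ ?_
    rw [htx]
    exact (mul_le_mul_of_nonneg_left (hR x hx) ht0.le).trans htR'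
  refine lt_of_le_of_lt ?_ ht
  rw [ContinuousMap.coe_zero, Pi.zero_apply, dist_zero_left]
  change ‖VectorField.iteratedDerivative n ((t ^ N)⁻¹ • dilate t f) x‖ ≤ _
  rw [hval, norm_smul, norm_smul, norm_inv, norm_pow, norm_pow, Real.norm_of_nonneg ht0.le]
  have h1 : ‖x‖ ^ (N + 1 - n) ≤ R ^ (N + 1) :=
    (pow_le_pow_left₀ (norm_nonneg x) (hR x hx) _).trans (pow_le_pow_right₀ hR1 (by omega))
  have h2 : t ^ n * t ^ (N + 1 - n) ≤ t ^ (N + 1) := by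
    rw [← pow_add]
    exact pow_le_pow_of_le_one ht0.le ht1 (by omega)
  calc (t ^ N)⁻¹ * (t ^ n * ‖iteratedFDeriv ℝ n f (t • x)‖)
      ≤ (t ^ N)⁻¹ * (t ^ n * (C * (t * ‖x‖) ^ (N + 1 - n))) := by gcongr
    _ = (t ^ N)⁻¹ * (C * ((t ^ n * t ^ (N + 1 - n)) * ‖x‖ ^ (N + 1 - n))) := by
        rw [mul_pow]
        ring
    _ ≤ (t ^ N)⁻¹ * (C * (t ^ (N + 1) * R ^ (N + 1))) := by gcongr
    _ = C * R ^ (N + 1) * t := by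
        have : t ^ N ≠ 0 := (pow_pos ht0 N).ne'
        field_simp
        ring

/-! ### Equivariant maps at the origin -/

theorem toAffineEquiv_mem_affineGroup {d : ℕ} {H : Subgroup (Space d ≃ₗ[ℝ] Space d)}
    {A : Space d ≃ₗ[ℝ] Space d} (hA : A ∈ H) : A.toAffineEquiv ∈ affineGroup H := hA

theorem smulOfUnit_affineAct {d : ℕ} {t : ℝ} (ht : t ≠ 0) (f : VectorField d) :
    f.affineAct (LinearEquiv.smulOfUnit (Units.mk0 t ht)⁻¹ :
      Space d ≃ₗ[ℝ] Space d).toAffineEquiv = t⁻¹ • dilate t f := by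
  refine Subtype.ext (funext fun x => ?_)
  have : (LinearEquiv.smulOfUnit (Units.mk0 t ht)⁻¹ : Space d ≃ₗ[ℝ] Space d).symm x = t • x := by
    rw [LinearEquiv.symm_apply_eq]
    change x = t⁻¹ • t • x
    rw [smul_smul, inv_mul_cancel₀ ht, one_smul]
  exact congrArg (fun y => t⁻¹ • f y) this

/-- The equivariance of a map of vector fields. -/
def IsEquivariant {d m : ℕ} (H : Subgroup (Space d ≃ₗ[ℝ] Space d))
    (φ : ContinuousMultilinearMap ℝ (fun _ : Fin m => VectorField d) (VectorField d)) : Prop :=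
  ∀ g ∈ affineGroup H, ∀ f : Fin m → VectorField d,
    φ (fun i => (f i).affineAct g) = (φ f).affineAct g

section

variable {d m : ℕ} {H : Subgroup (Space d ≃ₗ[ℝ] Space d)}
  {φ : ContinuousMultilinearMap ℝ (fun _ : Fin m => VectorField d) (VectorField d)}

/-- The scaling `x ↦ x/t` fixes the origin; it acts by `t⁻¹` times a dilation, so `m` such factors
come from the arguments and one from the value. -/
theorem IsEquivariant.apply_dilate (hφ : IsEquivariant H φ)
    (hH : ∀ c : ℝˣ, LinearEquiv.smulOfUnit c ∈ H) {t : ℝ} (ht : t ≠ 0)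
    (f : Fin m → VectorField d) :
    (t ^ m)⁻¹ • (φ fun i => dilate t (f i)) 0 = t⁻¹ • φ f 0 := by
  have h := hφ _ (toAffineEquiv_mem_affineGroup (hH (Units.mk0 t ht)⁻¹)) f
  simp only [smulOfUnit_affineAct] at h
  have h' := φ.toMultilinearMap.map_smul_univ (fun _ => t⁻¹) fun i => dilate t (f i)
  have h0 := congrArg (fun g : VectorField d => g 0) (h'.symm.trans h)
  simp only [Finset.prod_const, Finset.card_univ, Fintype.card_fin, inv_pow] at h0
  change (t ^ m)⁻¹ • (φ fun i => dilate t (f i)) 0 = t⁻¹ • φ f (t • 0) at h0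
  rwa [smul_zero] at h0

/-- A continuous equivariant map only depends on the `(m - 1)`-jets. -/
theorem IsEquivariant.apply_eq_zero_of_flat (hφ : IsEquivariant H φ)
    (hH : ∀ c : ℝˣ, LinearEquiv.smulOfUnit c ∈ H) (f : Fin m → VectorField d) (i : Fin m)
    (hf : ∀ n < m, iteratedFDeriv ℝ n (f i) 0 = 0) : φ f 0 = 0 := by
  obtain ⟨N, rfl⟩ : ∃ N, m = N + 1 := ⟨m - 1, by have := i.2; omega⟩
  -- With `N = m - 1`, the whole factor `t^(-N)` is put into the flat slot. The value does not
  -- depend on `t`, while the arguments converge to a tuple with a zero entry.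
  have key : ∀ t : ℝ, 0 < t → (φ (Function.update (fun k => dilate t (f k)) i
      ((t ^ N)⁻¹ • dilate t (f i)))) 0 = φ f 0 := by
    intro t ht
    rw [φ.map_update_smul, Function.update_eq_self i fun k => dilate t (f k)]
    change (t ^ N)⁻¹ • (φ fun k => dilate t (f k)) 0 = _
    have h := congrArg (t • ·) (hφ.apply_dilate hH ht.ne' f)
    simp only [smul_smul, mul_inv_cancel₀ ht.ne', one_smul] at h
    rw [← h]
    congr 1
    field_simp
    ring
  have hlim : Tendsto (fun t : ℝ => Function.update (fun k => dilate t (f k)) i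
      ((t ^ N)⁻¹ • dilate t (f i))) (𝓝[>] 0)
      (𝓝 (Function.update (fun k => dilate 0 (f k)) i 0)) := by
    refine tendsto_pi_nhds.mpr fun k => ?_
    by_cases hk : k = i
    · subst hk
      simpa using tendsto_dilate_of_flat hf
    · simpa [hk] using ((continuous_dilate (f k)).tendsto 0).mono_left nhdsWithin_le_nhds
  have h1 := ((continuous_eval_field (0 : Space d)).comp φ.cont).tendsto
    (Function.update (fun k => dilate 0 (f k)) i 0) |>.comp hlim
  have h2 : Tendsto (fun _ : ℝ => φ f 0) (𝓝[>] 0) (𝓝 (φ f 0)) := tendsto_const_nhds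
  have h3 : (φ (Function.update (fun k => dilate 0 (f k)) i 0)) 0 = 0 := by
    have h : φ (Function.update (fun k => dilate 0 (f k)) i 0) = 0 := φ.map_update_zero _ _
    rw [h]
    rfl
  refine (tendsto_nhds_unique h2 (h1.congr' ?_)).trans h3
  filter_upwards [self_mem_nhdsWithin] with t ht
  exact key t ht

/-- The arguments are exchanged one at a time, since a field minus its Taylor polynomial is flat
enough for `IsEquivariant.apply_eq_zero_of_flat`. -/
theorem IsEquivariant.apply_taylorField (hφ : IsEquivariant H φ)
    (hH : ∀ c : ℝˣ, LinearEquiv.smulOfUnit c ∈ H) (f : Fin m → VectorField d) :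
    (φ fun i => taylorField m (f i)) 0 = φ f 0 := by
  classical
  have key : ∀ s : Finset (Fin m),
      φ (fun i => if i ∈ s then taylorField m (f i) else f i) 0 = φ f 0 := by
    intro s
    induction s using Finset.induction_on with
    | empty => simp
    | insert a s ha ih =>
      rw [← ih]
      have h := hφ.apply_eq_zero_of_flat hH
        (Function.update (fun i => if i ∈ s then taylorField m (f i) else f i) a
          (taylorField m (f a) - f a)) a fun n hn => by
          rw [Function.update_self, iteratedFDeriv_sub_field, iteratedFDeriv_taylorField _ hn,
            sub_self]
      rw [φ.map_update_sub] at h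
      have h' := sub_eq_zero.mp (show _ - _ = (0 : Space d) from h)
      convert h' using 1
      · refine congrArg (fun w => φ w 0) (funext fun i => ?_)
        by_cases hi : i = a
        · subst hi
          simp
        · simp [hi]
      · refine congrArg (fun w => φ w 0) (funext fun i => ?_)
        by_cases hi : i = a
        · subst hi
          simp [ha]
        · simp [hi]
  simpa using key Finset.univ

/-- The translate `x ↦ f (x + b)`. -/
def translate (b : Space d) (f : VectorField d) : VectorField d :=
  ⟨fun x => f (x + b), f.contDiff.comp (contDiff_id.add contDiff_const)⟩

theorem translate_eq_affineAct (b : Space d) (f : VectorField d) :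
    translate b f = f.affineAct (AffineEquiv.constVAdd ℝ (Space d) (-b)) := by
  refine Subtype.ext (funext fun x => ?_)
  change f (x + b) = f (-(-b) + x)
  rw [neg_neg, add_comm]

theorem constVAdd_mem_affineGroup (b : Space d) :
    AffineEquiv.constVAdd ℝ (Space d) b ∈ affineGroup H :=
  H.one_mem

theorem IsEquivariant.apply_translate (hφ : IsEquivariant H φ) (f : Fin m → VectorField d)
    (b : Space d) : (φ fun i => translate b (f i)) = translate b (φ f) := by
  simp only [translate_eq_affineAct]
  exact hφ _ (constVAdd_mem_affineGroup _) f

theorem IsEquivariant.apply_eq (hφ : IsEquivariant H φ) (f : Fin m → VectorField d)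
    (b : Space d) : φ f b = (φ fun i => translate b (f i)) 0 := by
  rw [hφ.apply_translate]
  change _ = φ f (0 + b)
  rw [zero_add]

/-- Continuous equivariant maps are local. -/
theorem IsEquivariant.tsupport_subset (hφ : IsEquivariant H φ)
    (hH : ∀ c : ℝˣ, LinearEquiv.smulOfUnit c ∈ H) (f : Fin m → VectorField d) :
    tsupport (φ f) ⊆ tsupport fun x (i : Fin m) => f i x := by
  refine closure_minimal (fun x hx => ?_) (isClosed_tsupport _)
  by_contra hxf
  refine hx ?_
  rw [hφ.apply_eq]
  -- Without arguments there is no flat slot, but scaling by `2` shows that the value equals half of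
  -- itself. For `m > 0` every argument vanishes near the translated point, so slot `0` serves.
  rcases Nat.eq_zero_or_pos m with rfl | hm
  · have h := hφ.apply_dilate hH (two_ne_zero (α := ℝ)) fun i => translate x (f i)
    rw [show (fun i => dilate 2 (translate x (f i))) = fun i => translate x (f i) from
      Subsingleton.elim _ _, pow_zero, inv_one, one_smul] at h
    have h2 := sub_eq_zero.mpr h
    rw [← one_smul ℝ (φ _ 0), smul_smul, ← sub_smul] at h2
    exact (smul_eq_zero.mp h2).resolve_left (by norm_num)
  · refine hφ.apply_eq_zero_of_flat hH _ ⟨0, hm⟩ fun n _ => ?_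
    have hz := notMem_tsupport_iff_eventuallyEq.mp hxf
    have ht : Tendsto (fun y : Space d => y + x) (𝓝 0) (𝓝 x) := by
      have := (continuous_add_const x).tendsto (0 : Space d)
      rwa [zero_add] at this
    have hz' : (translate x (f ⟨0, hm⟩) : Space d → Space d) =ᶠ[𝓝 0] fun _ => 0 := by
      filter_upwards [ht.eventually hz] with y hy
      exact congrFun hy ⟨0, hm⟩
    rw [(hz'.iteratedFDeriv ℝ n).eq_of_nhds]
    simp

end

/-! ### Families of functions that depend continuously on a parameter, with all derivatives -/

section JointlySmooth

variable {Y : Type} [TopologicalSpace Y] {E F F₁ : Type}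
  [NormedAddCommGroup E] [NormedSpace ℝ E] [NormedAddCommGroup F] [NormedSpace ℝ F]
  [NormedAddCommGroup F₁] [NormedSpace ℝ F₁]

/-- A family of smooth functions all of whose derivatives are jointly continuous in the parameter
and the variable. -/
def JointlySmooth (Φ : Y → E → F) : Prop :=
  (∀ y, ContDiff ℝ ∞ (Φ y)) ∧ ∀ n : ℕ, Continuous fun p : Y × E => iteratedFDeriv ℝ n (Φ p.1) p.2

theorem JointlySmooth.continuous {Φ : Y → E → F} (h : JointlySmooth Φ) :
    Continuous fun p : Y × E => Φ p.1 p.2 := by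
  have := (continuousMultilinearCurryFin0 ℝ E F).continuous.comp (h.2 0)
  simpa [Function.comp_def, iteratedFDeriv_zero_eq_comp] using this

theorem JointlySmooth.comp_param {Z : Type} [TopologicalSpace Z] {Φ : Y → E → F}
    (h : JointlySmooth Φ) {g : Z → Y} (hg : Continuous g) : JointlySmooth fun z => Φ (g z) :=
  ⟨fun z => h.1 (g z), fun n => (h.2 n).comp (hg.prodMap continuous_id)⟩

theorem JointlySmooth.derivative {Φ : Y → E → F} (h : JointlySmooth Φ) :
    JointlySmooth fun y => fderiv ℝ (Φ y) := by
  refine ⟨fun y => (h.1 y).fderiv_right (by simp), fun n => ?_⟩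
  have := (continuousMultilinearCurryRightEquiv' ℝ n E F).continuous.comp (h.2 (n + 1))
  simpa [Function.comp_def, iteratedFDeriv_succ_eq_comp_right] using this

theorem jointlySmooth_const (c : F) : JointlySmooth fun (_ : Y) (_ : E) => c :=
  ⟨fun _ => contDiff_const, fun n => by
    cases n with
    | zero =>
      simp only [iteratedFDeriv_zero_eq_comp, Function.comp_def]
      exact continuous_const
    | succ n => simpa [iteratedFDeriv_const_of_ne (Nat.succ_ne_zero n)] using! continuous_const⟩

theorem JointlySmooth.add {Φ Ψ : Y → E → F} (h : JointlySmooth Φ) (k : JointlySmooth Ψ) :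
    JointlySmooth fun y x => Φ y x + Ψ y x := by
  refine ⟨fun y => (h.1 y).add (k.1 y), fun n => ((h.2 n).add (k.2 n)).congr fun p => ?_⟩
  exact (iteratedFDeriv_add_apply ((h.1 p.1).contDiffAt.of_le (by exact_mod_cast le_top))
    ((k.1 p.1).contDiffAt.of_le (by exact_mod_cast le_top))).symm

theorem JointlySmooth.sum {ι : Type} {Φ : ι → Y → E → F} (s : Finset ι)
    (h : ∀ i ∈ s, JointlySmooth (Φ i)) : JointlySmooth fun y x => ∑ i ∈ s, Φ i y x := by
  classical
  induction s using Finset.induction_on with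
  | empty => simpa using jointlySmooth_const (0 : F)
  | insert a s ha ih =>
    simp only [Finset.sum_insert ha]
    exact (h a (Finset.mem_insert_self a s)).add
      (ih fun i hi => h i (Finset.mem_insert_of_mem hi))

theorem JointlySmooth.clm_comp {Φ : Y → E → F} (h : JointlySmooth Φ) (L : F →L[ℝ] F₁) :
    JointlySmooth fun y x => L (Φ y x) := by
  refine ⟨fun y => L.contDiff.comp (h.1 y), fun n => ?_⟩
  refine ((ContinuousLinearMap.compContinuousMultilinearMapL ℝ (fun _ : Fin n => E) F F₁ L
    ).continuous.comp (h.2 n)).congr fun p => ?_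
  exact (L.iteratedFDeriv_comp_left (h.1 p.1).contDiffAt
    (by exact_mod_cast le_top)).symm

end JointlySmooth

/-- The Leibniz rule: bilinear maps preserve jointly smooth families. -/
theorem JointlySmooth.bilinear {Y E : Type} [TopologicalSpace Y] [NormedAddCommGroup E]
    [NormedSpace ℝ E] {F₁ F₂ F : Type} [NormedAddCommGroup F] [NormedSpace ℝ F]
    [NormedAddCommGroup F₁] [NormedSpace ℝ F₁] [NormedAddCommGroup F₂] [NormedSpace ℝ F₂]
    (B : F₁ →L[ℝ] F₂ →L[ℝ] F) {Φ : Y → E → F₁} {Ψ : Y → E → F₂}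
    (h : JointlySmooth Φ) (k : JointlySmooth Ψ) : JointlySmooth fun y x => B (Φ y x) (Ψ y x) := by
  have smooth : ∀ {G₁ G₂ G : Type} [NormedAddCommGroup G] [NormedSpace ℝ G]
      [NormedAddCommGroup G₁] [NormedSpace ℝ G₁] [NormedAddCommGroup G₂] [NormedSpace ℝ G₂]
      (B : G₁ →L[ℝ] G₂ →L[ℝ] G) {Φ : Y → E → G₁} {Ψ : Y → E → G₂},
      JointlySmooth Φ → JointlySmooth Ψ → ∀ y, ContDiff ℝ ∞ fun x => B (Φ y x) (Ψ y x) :=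
    fun {_ _ _} _ _ _ _ _ _ B {Φ Ψ} h k y => B.isBoundedBilinearMap.contDiff.comp ((h.1 y).prodMk (k.1 y))
  refine ⟨smooth B h k, fun n => ?_⟩
  induction n generalizing F₁ F₂ F with
  | zero =>
    simp only [iteratedFDeriv_zero_eq_comp]
    exact (continuousMultilinearCurryFin0 ℝ E F).symm.continuous.comp
      (B.isBoundedBilinearMap.continuous.comp (h.continuous.prodMk k.continuous))
  | succ n ih =>
    -- The derivative is a sum of two expressions of the same kind with operator-valued bilinear
    -- maps; hence the induction generalizes over the target spaces.
    have e : ∀ y, (fun x => fderiv ℝ (fun x => B (Φ y x) (Ψ y x)) x) = fun x =>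
        B.precompR E (Φ y x) (fderiv ℝ (Ψ y) x) + B.precompL E (fderiv ℝ (Φ y) x) (Ψ y x) :=
      fun y => funext fun x => B.fderiv_of_bilinear ((h.1 y).differentiable (by simp) x)
        ((k.1 y).differentiable (by simp) x)
    simp only [iteratedFDeriv_succ_eq_comp_right, e]
    refine (continuousMultilinearCurryRightEquiv' ℝ n E F).symm.continuous.comp ?_
    refine ((ih (B.precompR E) h k.derivative).add (ih (B.precompL E) h.derivative k)).congr fun p => ?_
    exact (iteratedFDeriv_add_apply
      ((smooth (B.precompR E) h k.derivative p.1).contDiffAt.of_le (by exact_mod_cast le_top))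
      ((smooth (B.precompL E) h.derivative k p.1).contDiffAt.of_le (by exact_mod_cast le_top))).symm

theorem JointlySmooth.prod {Y E ι : Type} [TopologicalSpace Y] [NormedAddCommGroup E]
    [NormedSpace ℝ E] {Φ : ι → Y → E → ℝ} (s : Finset ι) (h : ∀ i ∈ s, JointlySmooth (Φ i)) :
    JointlySmooth fun y x => ∏ i ∈ s, Φ i y x := by
  classical
  induction s using Finset.induction_on with
  | empty => simpa using jointlySmooth_const (1 : ℝ)
  | insert a s ha ih =>
    simp only [Finset.prod_insert ha]
    exact JointlySmooth.bilinear (ContinuousLinearMap.mul ℝ ℝ) (h a (Finset.mem_insert_self a s))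
      (ih fun i hi => h i (Finset.mem_insert_of_mem hi))

theorem jointlySmooth_iteratedFDeriv {d : ℕ} (j : ℕ) :
    JointlySmooth fun f : VectorField d => iteratedFDeriv ℝ j f := by
  induction j with
  | zero =>
    have h : JointlySmooth fun f : VectorField d => (f : Space d → Space d) :=
      ⟨fun f => f.contDiff, continuous_iteratedFDeriv_uncurry⟩
    exact h.clm_comp (continuousMultilinearCurryFin0 ℝ (Space d)
      (Space d)).symm.toContinuousLinearEquiv.toContinuousLinearMap
  | succ j ih =>
    have h := ih.derivative.clm_comp (continuousMultilinearCurryLeftEquiv ℝ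
      (fun _ : Fin (j + 1) => Space d)
      (Space d)).symm.toContinuousLinearEquiv.toContinuousLinearMap
    simpa only [iteratedFDeriv_succ_eq_comp_left] using! h

/-! ### Local forms -/

/-- Translation as a linear map. -/
def translateHom {d : ℕ} (x : Space d) : VectorField d →ₗ[ℝ] VectorField d where
  toFun := translate x
  map_add' _ _ := rfl
  map_smul' _ _ := rfl

/-- The linear forms on vector fields whose values on translates are jointly smooth. -/
def localForms (d : ℕ) : Submodule ℝ (VectorField d → ℝ) where
  carrier := {l | IsLinearMap ℝ l ∧ JointlySmooth fun f x => l (translate x f)}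
  add_mem' {l k} hl hk :=
    ⟨(IsLinearMap.mk' l hl.1 + IsLinearMap.mk' k hk.1).isLinear, hl.2.add hk.2⟩
  zero_mem' := ⟨(0 : VectorField d →ₗ[ℝ] ℝ).isLinear, jointlySmooth_const (0 : ℝ)⟩
  smul_mem' c l hl := ⟨(c • IsLinearMap.mk' l hl.1).isLinear,
    hl.2.clm_comp (c • ContinuousLinearMap.id ℝ ℝ)⟩

theorem iteratedFDeriv_translate {d : ℕ} (x : Space d) (f : VectorField d) (n : ℕ) :
    iteratedFDeriv ℝ n (translate x f) 0 = iteratedFDeriv ℝ n f x := by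
  have := iteratedFDeriv_comp_add_right (𝕜 := ℝ) (f := f) n x 0
  rwa [zero_add] at this

/-- On generators `ξ ⊗ w` the value at the translate by `x` is `ξ (f^(j)(x) w)`, which is jointly
smooth in `f` and `x`; linearity does the rest. -/
theorem jetForms_le_localForms (d j : ℕ) : jetForms d j ≤ localForms d := by
  rintro _ ⟨v, rfl⟩
  change v ∈ (localForms d).comap (factorFun d j)
  induction v using TensorProduct.induction_on with
  | zero => exact zero_mem _
  | add v w hv hw => exact add_mem hv hw
  | tmul ξ s =>
    have hs : s ∈ Submodule.span ℝ (Set.range (SymmetricPower.tprod ℝ)) := by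
      rw [SymmetricPower.span_tprod_eq_top]
      trivial
    induction hs using Submodule.span_induction with
    | zero =>
      rw [TensorProduct.tmul_zero]
      exact zero_mem _
    | add s t _ _ hs ht =>
      rw [TensorProduct.tmul_add]
      exact add_mem hs ht
    | smul c s _ hs =>
      rw [TensorProduct.tmul_smul]
      exact Submodule.smul_mem _ c hs
    | mem s hs =>
      obtain ⟨w, rfl⟩ := hs
      have hval : ∀ f, factorFun d j (ξ ⊗ₜ SymmetricPower.tprod ℝ w) f =
          ξ (iteratedFDeriv ℝ j f 0 w) := fun f => factorEval_tmul f j ξ w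
      refine ⟨⟨fun f g => ?_, fun c f => ?_⟩, ?_⟩
      · have : iteratedFDeriv ℝ j (f + g : VectorField d) 0 =
            iteratedFDeriv ℝ j f 0 + iteratedFDeriv ℝ j g 0 :=
          congrArg (· (0 : Space d)) (map_add (VectorField.iteratedDerivative j) f g)
        simp [hval, this]
      · simp [hval, iteratedFDeriv_smul_field]
      · simp only [hval, iteratedFDeriv_translate]
        exact (jointlySmooth_iteratedFDeriv j).clm_comp
          (LinearMap.toContinuousLinearMap ξ ∘L
            ContinuousMultilinearMap.apply ℝ (fun _ : Fin j => Space d) (Space d) w)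

/-- Functions that are diagonals of multilinear maps with jointly smooth values on translates. -/
def localDiagonals (d m : ℕ) (W : Type) [NormedAddCommGroup W] [NormedSpace ℝ W] :
    Submodule ℝ (VectorField d → W) where
  carrier := {P | ∃ B : MultilinearMap ℝ (fun _ : Fin m => VectorField d) W,
    (∀ f, B (fun _ => f) = P f) ∧
      JointlySmooth fun (f : Fin m → VectorField d) x => B fun i => translate x (f i)}
  add_mem' := by
    rintro P Q ⟨B, hB, hB'⟩ ⟨C, hC, hC'⟩
    exact ⟨B + C, fun f => by simp [hB, hC], hB'.add hC'⟩
  zero_mem' := ⟨0, fun _ => rfl, jointlySmooth_const (0 : W)⟩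
  smul_mem' := by
    rintro c P ⟨B, hB, hB'⟩
    exact ⟨c • B, fun f => by simp [hB], hB'.clm_comp (c • ContinuousLinearMap.id ℝ W)⟩

/-- A product of `m` linear forms is the diagonal of the multilinear map with one form in each slot.
Symmetry is not required here. -/
theorem localForms_pow_le (d m : ℕ) : localForms d ^ m ≤ localDiagonals d m ℝ := by
  rw [Submodule.pow_eq_span_pow_set, Submodule.span_le]
  intro a ha
  obtain ⟨l, rfl⟩ := Set.mem_pow.mp ha
  refine ⟨(MultilinearMap.mkPiAlgebra ℝ (Fin m) ℝ).compLinearMap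
    fun i => IsLinearMap.mk' (l i).1 (l i).2.1, fun f => ?_, ?_⟩
  · simp [List.prod_ofFn]
  · simp only [MultilinearMap.compLinearMap_apply, MultilinearMap.mkPiAlgebra_apply]
    exact JointlySmooth.prod Finset.univ fun i _ => (l i).2.2.comp_param (continuous_apply i)

/-- Once the jet forms of all orders are enlarged to `localForms`, the exponents `κ j` add up to the
size. -/
theorem prodFun_mem_localDiagonals (d : ℕ) (κ : NatComposition)
    (s : ⨂[ℝ] j : κ.support, Sym[ℝ]^(κ j) (Factor d j)) :
    prodFun d κ s ∈ localDiagonals d κ.size ℝ := by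
  refine localForms_pow_le d _ ?_
  have h1 : prodFun d κ s ∈ ∏ j ∈ κ.support, jetForms d j ^ κ j := by
    rw [← range_prodFun]
    exact ⟨s, rfl⟩
  have h2 : ∏ j ∈ κ.support, jetForms d j ^ κ j ≤ ∏ j ∈ κ.support, localForms d ^ κ j :=
    Finset.prod_le_prod' fun j _ => pow_le_pow_left' (jetForms_le_localForms d j) _
  rw [Finset.prod_pow_eq_pow_sum] at h2
  exact h2 h1

theorem pairing_mem_localDiagonals (d : ℕ) (κ : NatComposition) (S : SymSpace d κ) :
    pairing d κ S ∈ localDiagonals d κ.size (Space d) := by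
  induction S using TensorProduct.induction_on with
  | zero =>
    rw [map_zero]
    exact zero_mem _
  | add S T hS hT =>
    rw [map_add]
    exact add_mem hS hT
  | tmul x s =>
    obtain ⟨B, hB, hB'⟩ := prodFun_mem_localDiagonals d κ s
    refine ⟨(LinearMap.toSpanSingleton ℝ (Space d) x).compMultilinearMap B, fun f => ?_, ?_⟩
    · have : pairing d κ (x ⊗ₜ s) f = prodFun d κ s f • x := contract_tmul (factorEval f) κ x s
      simp [hB, this]
    · exact hB'.clm_comp (ContinuousLinearMap.toSpanSingleton ℝ x)

/-! ### Construction of equivariant maps -/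

/-- The map of vector fields obtained by applying a multilinear map to translates. -/
def fieldMap {d m : ℕ} (B : MultilinearMap ℝ (fun _ : Fin m => VectorField d) (Space d))
    (hB : JointlySmooth fun (f : Fin m → VectorField d) x => B fun i => translate x (f i)) :
    ContinuousMultilinearMap ℝ (fun _ : Fin m => VectorField d) (VectorField d) where
  toFun f := ⟨fun x => B fun i => translate x (f i), hB.1 f⟩
  map_update_add' f i g h := Subtype.ext (funext fun x =>
    (B.compLinearMap fun _ => translateHom x).map_update_add f i g h)
  map_update_smul' f i c g := Subtype.ext (funext fun x =>
    (B.compLinearMap fun _ => translateHom x).map_update_smul f i c g)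
  cont := continuous_field_of_uncurry hB.2

/-- Moving both `x` and its preimage to the origin turns `g` into its linear part, so affine
equivariance reduces to linear equivariance at the origin. -/
theorem translate_affineAct {d : ℕ} (g : Space d ≃ᵃ[ℝ] Space d) (f : VectorField d)
    (x : Space d) :
    translate x (f.affineAct g) =
      (translate (g.symm x) f).affineAct g.linear.toAffineEquiv := by
  refine Subtype.ext (funext fun y => ?_)
  have h : g.symm (y + x) = g.linear.symm y + g.symm x := g.symm.map_vadd x y
  exact congrArg (fun z => g.linear (f z)) h

/-- The linear action of the linear group on vector fields. -/
def linearActHom {d : ℕ} (A : Space d ≃ₗ[ℝ] Space d) : VectorField d →ₗ[ℝ] VectorField d where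
  toFun f := f.affineAct A.toAffineEquiv
  map_add' _ _ := Subtype.ext (funext fun _ => map_add A _ _)
  map_smul' c _ := Subtype.ext (funext fun _ => map_smul A c _)

/-- Symmetrizing keeps the diagonal. Equivariance of `P` then passes to the multilinear map by
polarization, and evaluation on translates adds equivariance under translations. Locality is
automatic. -/
theorem exists_equivariant_of_mem_localDiagonals {d m : ℕ}
    {H : Subgroup (Space d ≃ₗ[ℝ] Space d)} (hH : ∀ c : ℝˣ, LinearEquiv.smulOfUnit c ∈ H)
    {P : VectorField d → Space d} (hP : P ∈ localDiagonals d m (Space d))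
    (hPH : ∀ A ∈ H, ∀ f : VectorField d, P (f.affineAct A.toAffineEquiv) = A (P f)) :
    ∃ φ : localEquivariantMaps H m, ∀ f, (φ.1 fun _ => f) 0 = P f := by
  obtain ⟨B₀, hdiag, hsmooth⟩ := hP
  have hm : ((m.factorial : ℕ) : ℝ) ≠ 0 := by exact_mod_cast m.factorial_ne_zero
  let B : MultilinearMap ℝ (fun _ : Fin m => VectorField d) (Space d) :=
    (m.factorial : ℝ)⁻¹ • ∑ σ : Equiv.Perm (Fin m), B₀.domDomCongr σ
  have hB : ∀ f, B f = (m.factorial : ℝ)⁻¹ • ∑ σ : Equiv.Perm (Fin m), B₀ fun i => f (σ i) := by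
    intro f
    simp [B]
  have hBdiag : ∀ f, B (fun _ => f) = P f := by
    intro f
    simp only [hB, hdiag, Finset.sum_const, Finset.card_univ, Fintype.card_perm, Fintype.card_fin]
    rw [← Nat.cast_smul_eq_nsmul ℝ, smul_smul, inv_mul_cancel₀ hm, one_smul]
  have hBsym : ∀ (τ : Equiv.Perm (Fin m)) f, B (fun i => f (τ i)) = B f := by
    intro τ f
    rw [hB, hB]
    congr 1
    exact Equiv.sum_comp (Equiv.mulLeft τ) fun σ => B₀ fun i => f (σ i)
  have hBsmooth : JointlySmooth fun (f : Fin m → VectorField d) x =>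
      B fun i => translate x (f i) := by
    simp only [hB]
    refine JointlySmooth.clm_comp (JointlySmooth.sum Finset.univ fun σ _ => ?_)
      ((m.factorial : ℝ)⁻¹ • ContinuousLinearMap.id ℝ (Space d))
    exact hsmooth.comp_param (g := fun (f : Fin m → VectorField d) i => f (σ i))
      (continuous_pi fun i => continuous_apply (σ i))
  have hBact : ∀ A ∈ H, ∀ f : Fin m → VectorField d,
      B (fun i => (f i).affineAct A.toAffineEquiv) = A (B f) := by
    intro A hA f
    have h := eq_zero_of_diagonal_eq_zero
      (B.compLinearMap (fun _ => linearActHom A) - A.toLinearMap.compMultilinearMap B) ?_ ?_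
    · exact sub_eq_zero.mp (congrArg (fun C => C f) h)
    · intro σ v
      have h1 := hBsym σ fun i => linearActHom A (v i)
      simp [h1, hBsym]
    · intro v
      have h1 : P (linearActHom A v) = A (P v) := hPH A hA v
      simp [hBdiag, h1]
  have hequiv : IsEquivariant H (fieldMap B hBsmooth) := by
    intro g hg f
    refine Subtype.ext (funext fun x => ?_)
    change B (fun i => translate x ((f i).affineAct g)) =
      g.linear (B fun i => translate (g.symm x) (f i))
    simp only [translate_affineAct]
    exact hBact _ hg _
  refine ⟨⟨fieldMap B hBsmooth, fun σ f => Subtype.ext (funext fun x =>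
    hBsym σ fun i => translate x (f i)), hequiv.tsupport_subset hH, hequiv⟩, fun f => ?_⟩
  have h0 : translate 0 f = f := Subtype.ext (funext fun x => congrArg f (add_zero x))
  change B (fun _ => translate 0 f) = P f
  rw [h0, hBdiag]

/-! ### Injectivity of the pairing -/

/-- Contractions belonging to different compositions are linearly independent. -/
theorem eq_zero_of_sum_symSpaceEval_eq_zero {d : ℕ} {ι : Type} {c : ι → NatComposition}
    (hc : Function.Injective c) (s : Finset ι) (S : ∀ i, SymSpace d (c i))
    (h : ∀ f : VectorField d, ∑ i ∈ s, symSpaceEval f (c i) (S i) = 0) :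
    ∀ i ∈ s, S i = 0 := by
  classical
  intro i₀ hi₀
  refine eq_zero_of_contract_eq_zero _ fun l => ?_
  -- Only finitely many orders occur, so some field has the jet forms `t j • l j` in all of them.
  -- The identity becomes a polynomial one in the free parameters `t j`, with exponents `c i`
  -- distinct by injectivity.
  have hsum : ∀ t : ℕ → ℝ,
      ∑ i ∈ s, (∏ j ∈ (c i).support, t j ^ c i j) • contract l (c i) (S i) = 0 := by
    intro t
    obtain ⟨f, hf⟩ := exists_factorEval_eq (fun j => t j • l j) (s.biUnion fun i => (c i).support)
    rw [← h f]
    refine Finset.sum_congr rfl fun i hi => ?_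
    rw [symSpaceEval_eq_contract, contract_congr (l' := fun j => t j • l j) fun j hj =>
      hf j (Finset.mem_biUnion.mpr ⟨i, hi, hj⟩), contract_smul]
    rfl
  ext k
  let p : MvPolynomial ℕ ℝ := ∑ i ∈ s, MvPolynomial.monomial (c i) (contract l (c i) (S i) k)
  have hp : p = 0 := by
    refine MvPolynomial.funext fun t => ?_
    have := congrArg (fun x : Space d => x k) (hsum t)
    simp only [WithLp.ofLp_sum, Finset.sum_apply, PiLp.smul_apply, smul_eq_mul,
      PiLp.zero_apply] at this
    rw [map_zero, ← this]
    simp only [p, map_sum, MvPolynomial.eval_monomial]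
    exact Finset.sum_congr rfl fun i _ => mul_comm _ _
  have := congrArg (MvPolynomial.coeff (c i₀)) hp
  simp only [p, MvPolynomial.coeff_sum, MvPolynomial.coeff_monomial, hc.eq_iff,
    MvPolynomial.coeff_zero] at this
  simpa [hi₀] using this

theorem eq_zero_of_symSpaceEval_eq_zero {d : ℕ} {κ : NatComposition} {S : SymSpace d κ}
    (h : ∀ f : VectorField d, symSpaceEval f κ S = 0) : S = 0 :=
  eq_zero_of_sum_symSpaceEval_eq_zero (ι := Unit) (c := fun _ => κ)
    (Function.injective_of_subsingleton _) Finset.univ (fun _ => S) (by simpa using h) () (by simp)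

/-! ### The action of the linear group on jets -/

/-- For linear `A` the chain rule has no lower-order terms: the derivative at `0` transforms as a
tensor, and the dual actions on `M*` and `sym^j M` cancel against it. -/
theorem factorEval_affineAct {d : ℕ} {H : Subgroup (Space d ≃ₗ[ℝ] Space d)} (A : H)
    (f : VectorField d) (j : ℕ) :
    factorEval (f.affineAct A.1.toAffineEquiv) j ∘ₗ factorRep H j A = factorEval f j := by
  refine factor_hom_ext fun ξ v => ?_
  have h1 : factorRep H j A (ξ ⊗ₜ SymmetricPower.tprod ℝ v) =
      (stdRep H).dual A ξ ⊗ₜ symMap j (stdRep H A) (SymmetricPower.tprod ℝ v) := rfl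
  have h2 : iteratedFDeriv ℝ j (f.affineAct A.1.toAffineEquiv) 0 =
      (A.1.toContinuousLinearEquiv : Space d →L[ℝ] Space d).compContinuousMultilinearMap
        ((iteratedFDeriv ℝ j f 0).compContinuousLinearMap fun _ =>
          (A.1.symm.toContinuousLinearEquiv : Space d →L[ℝ] Space d)) := by
    have e1 := (A.1.toContinuousLinearEquiv : Space d →L[ℝ] Space d).iteratedFDeriv_comp_left
      (f := (f : Space d → Space d) ∘ (A.1.symm.toContinuousLinearEquiv : Space d →L[ℝ] Space d))
      (x := 0) (i := j) (n := ∞)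
      (f.contDiff.comp (ContinuousLinearMap.contDiff _)).contDiffAt (by exact_mod_cast le_top)
    rw [(A.1.symm.toContinuousLinearEquiv : Space d →L[ℝ] Space d).iteratedFDeriv_comp_right
      f.contDiff 0 (by exact_mod_cast le_top), map_zero] at e1
    exact e1
  rw [LinearMap.comp_apply, h1, symMap_tprod, factorEval_tmul, factorEval_tmul, h2]
  have h3 : ∀ y : Space d, (stdRep H).dual A ξ y = ξ (A.1.symm y) := fun _ => rfl
  have h4 : ∀ y : Space d, stdRep H A y = A.1 y := fun _ => rfl
  rw [h3]
  simp [h4]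

theorem symSpaceEval_affineAct {d : ℕ} {H : Subgroup (Space d ≃ₗ[ℝ] Space d)} (A : H)
    (f : VectorField d) (κ : NatComposition) (S : SymSpace d κ) :
    symSpaceEval (f.affineAct A.1.toAffineEquiv) κ (symSpaceRep H κ A S) =
      A.1 (symSpaceEval f κ S) :=
  contract_symSpaceRep A (fun j => factorEval_affineAct A f j) κ S

theorem size_eq_sum (κ : NatComposition) : κ.size = ∑ j ∈ κ.support, κ j := rfl

theorem derived_size_eq_sum (κ : NatComposition) :
    κ.derived.size = ∑ j ∈ κ.support, j * κ j :=
  Finsupp.onFinset_sum _ fun _ => rfl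

theorem factorEval_smul_dilate {d : ℕ} (c t : ℝ) (f : VectorField d) (j : ℕ) :
    factorEval (c • dilate t f) j = (c * t ^ j) • factorEval f j := by
  refine factor_hom_ext fun ξ v => ?_
  rw [LinearMap.smul_apply, factorEval_tmul, factorEval_tmul, iteratedFDeriv_smul_field,
    iteratedFDeriv_dilate]
  simp [mul_assoc]

theorem symSpaceEval_smul_dilate {d : ℕ} (c t : ℝ) (f : VectorField d) (κ : NatComposition)
    (S : SymSpace d κ) :
    symSpaceEval (c • dilate t f) κ S =
      (c ^ κ.size * t ^ κ.derived.size) • symSpaceEval f κ S := by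
  have h : factorEval (c • dilate t f) = fun j => (c * t ^ j) • factorEval f j :=
    funext fun j => factorEval_smul_dilate c t f j
  rw [symSpaceEval_eq_contract, h, contract_smul, LinearMap.smul_apply]
  congr 1
  rw [derived_size_eq_sum, size_eq_sum]
  simp only [mul_pow, Finset.prod_mul_distrib, ← pow_mul, Finset.prod_pow_eq_pow_sum]

/-- Invariance under scalings fixes the weight. -/
theorem eq_zero_of_mem_invariants {d : ℕ} {H : Subgroup (Space d ≃ₗ[ℝ] Space d)}
    (hH : ∀ c : ℝˣ, LinearEquiv.smulOfUnit c ∈ H) {κ : NatComposition} {S : SymSpace d κ}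
    (hS : S ∈ (symSpaceRep H κ).invariants) (hκ : κ.derived.size + 1 ≠ κ.size) : S = 0 := by
  refine eq_zero_of_symSpaceEval_eq_zero fun f => ?_
  have h2 : (2 : ℝ) ≠ 0 := two_ne_zero
  -- The scaling by `1/2` suffices: it gives `2^(|κ'|-|κ|) = 2^(-1)` unless the contraction
  -- vanishes, and powers of `2` are distinct.
  have h := symSpaceEval_affineAct ⟨_, hH (Units.mk0 2 h2)⁻¹⟩ f κ S
  rw [hS, smulOfUnit_affineAct, symSpaceEval_smul_dilate] at h
  replace h : ((2 : ℝ)⁻¹ ^ κ.size * 2 ^ κ.derived.size) • symSpaceEval f κ S =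
    (2 : ℝ)⁻¹ • symSpaceEval f κ S := h
  rw [← sub_eq_zero, ← sub_smul] at h
  refine (smul_eq_zero.mp h).resolve_left fun h0 => hκ ?_
  refine Nat.pow_right_injective (le_refl 2) ?_
  have h3 : (2 : ℝ) ^ (κ.derived.size + 1) = 2 ^ κ.size := by
    have h4 := sub_eq_zero.mp h0
    rw [inv_pow] at h4
    field_simp at h4
    rw [pow_succ, ← h4]
  exact_mod_cast h3

/-! ### The diagonal of an equivariant map as a sum of contractions -/

theorem finset_prod_mem_prod {A ι : Type} [CommRing A] [Algebra ℝ A] (s : Finset ι)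
    (p : ι → Submodule ℝ A) (a : ι → A) (h : ∀ i ∈ s, a i ∈ p i) :
    ∏ i ∈ s, a i ∈ ∏ i ∈ s, p i := by
  classical
  induction s using Finset.induction_on with
  | empty => exact Submodule.one_le.mp le_rfl
  | insert b s hb ih =>
    rw [Finset.prod_insert hb, Finset.prod_insert hb]
    exact Submodule.mul_mem_mul (h b (Finset.mem_insert_self b s))
      (ih fun i hi => h i (Finset.mem_insert_of_mem hi))

/-- A product of linear functions of derivatives of the given orders is a contraction. -/
theorem prod_smul_mem_range_pairing {d m : ℕ} (j : Fin m → ℕ) (l : Fin m → VectorField d → ℝ)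
    (hl : ∀ i, l i ∈ jetForms d (j i)) (x : Space d) :
    ∃ κ : NatComposition, κ.size = m ∧
      (fun f => (∏ i, l i f) • x) ∈ LinearMap.range (pairing d κ) := by
  -- `κ a` counts the slots that carry a derivative of order `a`.
  let κ : NatComposition := ∑ i, Finsupp.single (j i) 1
  have hprod : ∏ i, jetForms d (j i) = ∏ a ∈ κ.support, jetForms d a ^ κ a := by
    have := Finsupp.prod_finsetSum_index (s := Finset.univ)
      (g := fun i : Fin m => Finsupp.single (j i) 1) (h := fun a n => jetForms d a ^ n)
      (fun a => pow_zero _) (fun a => pow_add _)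
    simp only [Finsupp.prod_single_index, pow_zero, pow_one] at this
    exact this
  refine ⟨κ, ?_, ?_⟩
  · have := Finsupp.sum_finsetSum_index (s := Finset.univ)
      (g := fun i : Fin m => Finsupp.single (j i) 1) (h := fun _ n => n)
      (fun _ => rfl) (fun _ _ _ => rfl)
    simp only [Finsupp.sum_single_index, Finset.sum_const, Finset.card_univ, Fintype.card_fin,
      smul_eq_mul, mul_one] at this
    exact this.symm
  · have hmem : ∏ i, l i ∈ LinearMap.range (prodFun d κ) := by
      rw [range_prodFun, ← hprod]
      exact finset_prod_mem_prod _ _ _ fun i _ => hl i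
    obtain ⟨s, hs⟩ := hmem
    refine ⟨x ⊗ₜ s, funext fun f => ?_⟩
    have : pairing d κ (x ⊗ₜ s) f = prodFun d κ s f • x := contract_tmul (factorEval f) κ x s
    rw [this, hs, Finset.prod_apply]

/-- Taylor polynomials are finite combinations of monomial fields whose coefficients are jet forms;
multilinearity gives products of `m` jet forms times fixed vectors. -/
theorem IsEquivariant.diagonal_mem_iSup {d m : ℕ} {H : Subgroup (Space d ≃ₗ[ℝ] Space d)}
    {φ : ContinuousMultilinearMap ℝ (fun _ : Fin m => VectorField d) (VectorField d)}
    (hφ : IsEquivariant H φ) (hH : ∀ c : ℝˣ, LinearEquiv.smulOfUnit c ∈ H) :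
    (fun f => (φ fun _ => f) 0) ∈
      ⨆ κ : {κ : NatComposition // κ.size = m}, LinearMap.range (pairing d κ.1) := by
  classical
  let I := Σ j : Fin m, (Fin j → Fin d) × Fin d
  let v : ∀ a : I, Factor d a.1 := fun a =>
    (EuclideanSpace.basisFun (Fin d) ℝ).toBasis.coord a.2.2 ⊗ₜ
      SymmetricPower.tprod ℝ fun l => EuclideanSpace.basisFun (Fin d) ℝ (a.2.1 l)
  let p : I → VectorField d := fun a => ((a.1 : ℕ).factorial : ℝ)⁻¹ • monomialField a.2.1 a.2.2
  have hexp : (fun f => (φ fun _ => f) 0) = ∑ r : Fin m → I, fun f : VectorField d =>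
      (∏ i, factorFun d (r i).1 (v (r i)) f) • (φ fun i => p (r i)) 0 := by
    funext f
    rw [← hφ.apply_taylorField hH fun _ => f, Finset.sum_apply, taylorField_eq_sum]
    have h1 := φ.toMultilinearMap.map_sum fun (_ : Fin m) (a : I) =>
      factorFun d a.1 (v a) f • p a
    refine (congrArg (fun g : VectorField d => g 0) h1).trans ?_
    rw [sum_field_apply]
    refine Finset.sum_congr rfl fun r _ => ?_
    have h2 := φ.toMultilinearMap.map_smul_univ (fun i => factorFun d (r i).1 (v (r i)) f)
      fun i => p (r i)
    exact congrArg (fun g : VectorField d => g 0) h2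
  rw [hexp]
  refine Submodule.sum_mem _ fun r _ => ?_
  obtain ⟨κ, hκ, hmem⟩ := prod_smul_mem_range_pairing (fun i => ((r i).1 : ℕ))
    (fun i => factorFun d (r i).1 (v (r i))) (fun i => ⟨_, rfl⟩) ((φ fun i => p (r i)) 0)
  exact Submodule.mem_iSup_of_mem (p := fun κ : {κ : NatComposition // κ.size = m} =>
    LinearMap.range (pairing d κ.1)) ⟨κ, hκ⟩ hmem

/-! ### The isomorphism -/

/-- The compositions of size `m` whose derived composition has size `m - 1`. -/
abbrev Weights (m : ℕ) : Type := {κ : NatComposition // κ.size = m ∧ κ.derived.size + 1 = m}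

/-- Each `j` in the support satisfies `j ≤ j * κ j ≤ |κ'| < m`, so `κ` distributes `m` over a
bounded set of indices. -/
theorem finite_weights (m : ℕ) : Finite (Weights m) := by
  refine Finite.of_injective (β := (Finset.range (m + 1)).finsuppAntidiag m)
    (fun κ => ⟨κ.1, ?_⟩) fun κ κ' h => Subtype.ext (congrArg (fun x => x.1) h)
  have hsub : κ.1.support ⊆ Finset.range (m + 1) := by
    intro j hj
    have h1 : j * κ.1 j ≤ κ.1.derived.size := by
      rw [derived_size_eq_sum]
      exact Finset.single_le_sum (f := fun j => j * κ.1 j) (fun _ _ => Nat.zero_le _) hj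
    have h2 : 1 ≤ κ.1 j := Nat.one_le_iff_ne_zero.mpr (Finsupp.mem_support_iff.mp hj)
    have h3 := κ.2.2
    have h4 : j * 1 ≤ j * κ.1 j := Nat.mul_le_mul_left j h2
    rw [Finset.mem_range]
    omega
  rw [Finset.mem_finsuppAntidiag]
  refine ⟨?_, hsub⟩
  refine Eq.trans ?_ κ.2.1
  exact (Finset.sum_subset hsub fun j _ hj => Finsupp.notMem_support_iff.mp hj).symm

section

variable {d m : ℕ} (H : Subgroup (Space d ≃ₗ[ℝ] Space d))

/-- The value at the origin of the diagonal of an equivariant map. -/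
def diagonalAtOrigin (m : ℕ) : localEquivariantMaps H m →ₗ[ℝ] (VectorField d → Space d) where
  toFun φ f := (φ.1 fun _ => f) 0
  map_add' _ _ := rfl
  map_smul' _ _ := rfl

/-- The sum of the contractions with a family of invariant elements. -/
def totalPairing (m : ℕ) :
    (⨁ κ : Weights m, (symSpaceRep H κ.1).invariants) →ₗ[ℝ] (VectorField d → Space d) :=
  LinearMap.pi fun f => DirectSum.toModule ℝ _ (Space d) fun κ : Weights m =>
    symSpaceEval f κ.1 ∘ₗ (symSpaceRep H κ.1).invariants.subtype

theorem totalPairing_lof (κ : Weights m)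
    (S : (symSpaceRep H κ.1).invariants) :
    totalPairing H m (DirectSum.lof ℝ _ _ κ S) = pairing d κ.1 S.1 := by
  funext f
  rw [totalPairing, LinearMap.pi_apply, DirectSum.toModule_lof]
  rfl

theorem diagonalAtOrigin_injective : Function.Injective (diagonalAtOrigin H m) := by
  rw [injective_iff_map_eq_zero]
  intro φ h
  have hφ : IsEquivariant H φ.1 := φ.2.2.2
  let B : MultilinearMap ℝ (fun _ : Fin m => VectorField d) (Space d) :=
    ((LinearMap.proj (0 : Space d) : (Space d → Space d) →ₗ[ℝ] Space d) ∘ₗ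
      (smoothMaps d).subtype : VectorField d →ₗ[ℝ] Space d).compMultilinearMap
        φ.1.toMultilinearMap
  have hB : ∀ f, B f = φ.1 f 0 := fun _ => rfl
  have hB0 : B = 0 := eq_zero_of_diagonal_eq_zero B
    (fun σ f => by rw [hB, hB, φ.2.1 σ f]) fun f => congrFun h f
  refine Subtype.ext (ContinuousMultilinearMap.ext fun f => Subtype.ext (funext fun x => ?_))
  refine (hφ.apply_eq f x).trans ?_
  rw [← hB, hB0]
  rfl

theorem totalPairing_injective : Function.Injective (totalPairing H m) := by
  classical
  rw [injective_iff_map_eq_zero]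
  intro x hx
  have h := eq_zero_of_sum_symSpaceEval_eq_zero (d := d) (c := fun κ : Weights m => κ.1)
    Subtype.val_injective (DFinsupp.support x) (fun κ => (x κ).1) fun f => by
      have h1 := congrFun hx f
      rw [← DirectSum.sum_support_of x, map_sum, Finset.sum_apply] at h1
      refine Eq.trans (Finset.sum_congr rfl fun κ _ => ?_) h1
      exact (congrFun (totalPairing_lof H κ (x κ)) f).symm
  refine DFinsupp.ext fun κ => ?_
  by_cases hκ : κ ∈ DFinsupp.support x
  · exact Subtype.ext (h κ hκ)
  · exact DFinsupp.notMem_support_iff.mp hκ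

theorem range_totalPairing_le (hH : ∀ c : ℝˣ, LinearEquiv.smulOfUnit c ∈ H) :
    LinearMap.range (totalPairing H m) ≤ LinearMap.range (diagonalAtOrigin H m) := by
  classical
  rintro _ ⟨x, rfl⟩
  induction x using DirectSum.induction_on with
  | zero =>
    rw [map_zero]
    exact zero_mem _
  | add x y hx hy =>
    rw [map_add]
    exact add_mem hx hy
  | of κ S =>
    have hP : pairing d κ.1 S.1 ∈ localDiagonals d m (Space d) := by
      have := pairing_mem_localDiagonals d κ.1 S.1
      rwa [κ.2.1] at this
    obtain ⟨φ, hφ⟩ := exists_equivariant_of_mem_localDiagonals hH hP fun A hA f => by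
      have := symSpaceEval_affineAct ⟨A, hA⟩ f κ.1 S.1
      rwa [S.2] at this
    exact ⟨φ, (funext hφ).trans (totalPairing_lof H κ S).symm⟩

/-- The decomposition of `IsEquivariant.diagonal_mem_iSup` controls only the size of `κ`. Invariance
of its tensors comes from their uniqueness, and invariance kills those of the wrong weight. -/
theorem range_diagonalAtOrigin_le (hH : ∀ c : ℝˣ, LinearEquiv.smulOfUnit c ∈ H) :
    LinearMap.range (diagonalAtOrigin H m) ≤ LinearMap.range (totalPairing H m) := by
  classical
  rintro _ ⟨φ, rfl⟩
  have hφ : IsEquivariant H φ.1 := φ.2.2.2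
  obtain ⟨P, hP, hsum⟩ := (Submodule.mem_iSup_iff_exists_finsupp _ _).mp
    (hφ.diagonal_mem_iSup hH)
  choose S hS using hP
  have hdiag : ∀ f, ∑ κ ∈ P.support, symSpaceEval f κ.1 (S κ) = (φ.1 fun _ => f) 0 := by
    intro f
    have := congrFun hsum f
    rw [Finsupp.sum, Finset.sum_apply] at this
    rw [← this]
    exact Finset.sum_congr rfl fun κ _ => congrFun (hS κ) f
  have hinv : ∀ κ ∈ P.support, S κ ∈ (symSpaceRep H κ.1).invariants := by
    intro κ hκ A
    refine sub_eq_zero.mp (eq_zero_of_sum_symSpaceEval_eq_zero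
      (c := fun κ : {κ : NatComposition // κ.size = m} => κ.1) Subtype.val_injective P.support
      (fun κ => symSpaceRep H κ.1 A (S κ) - S κ) (fun f => ?_) κ hκ)
    -- Testing on transformed fields loses nothing, as `A` acts invertibly; on them both sums equal
    -- `A` applied to the diagonal at `g`.
    obtain ⟨g, rfl⟩ : ∃ g : VectorField d, g.affineAct A.1.toAffineEquiv = f :=
      ⟨f.affineAct A.1.symm.toAffineEquiv, Subtype.ext (funext fun x => by
        change A.1 (A.1.symm (f (A.1 (A.1.symm x)))) = f x
        simp)⟩
    simp only [map_sub, Finset.sum_sub_distrib, symSpaceEval_affineAct, hdiag]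
    rw [← map_sum, hdiag, sub_eq_zero]
    have h0 : (φ.1 fun _ => g.affineAct A.1.toAffineEquiv) 0 =
        A.1 ((φ.1 fun _ => g) (A.1.symm 0)) :=
      congrArg (fun h : VectorField d => h 0)
        (hφ _ (toAffineEquiv_mem_affineGroup A.2) fun _ => g)
    rw [h0, map_zero]
  have htot : diagonalAtOrigin H m φ = ∑ κ ∈ P.support, pairing d κ.1 (S κ) := by
    funext f
    rw [Finset.sum_apply]
    exact (hdiag f).symm
  rw [htot]
  refine Submodule.sum_mem _ fun κ hκ => ?_
  by_cases hw : κ.1.derived.size + 1 = m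
  · exact ⟨DirectSum.lof ℝ _ _ (⟨κ.1, κ.2, hw⟩ : Weights m) ⟨S κ, hinv κ hκ⟩,
      totalPairing_lof H _ _⟩
  · rw [eq_zero_of_mem_invariants hH (hinv κ hκ) (by rwa [κ.2]), map_zero]
    exact zero_mem _

end

end LocalEquivariant

end

theorem mainTheorem4 (d m : ℕ) (H : Subgroup (Space d ≃ₗ[ℝ] Space d))
    (hH : ∀ c : ℝˣ, LinearEquiv.smulOfUnit c ∈ H) :
    (∃ e : localEquivariantMaps H m ≃ₗ[ℝ]
        ⨁ κ : {κ : NatComposition // κ.size = m ∧ κ.derived.size + 1 = m},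
          (symSpaceRep H κ.1).invariants,
      ∀ (φ : localEquivariantMaps H m) (f : VectorField d),
        (φ.1 fun _ => f) 0 =
          DirectSum.toModule ℝ _ (Space d)
            (fun κ : {κ : NatComposition // κ.size = m ∧ κ.derived.size + 1 = m} =>
              symSpaceEval f κ.1 ∘ₗ (symSpaceRep H κ.1).invariants.subtype) (e φ)) ∧
    FiniteDimensional ℝ (localEquivariantMaps H m) := by
  have hrange : LinearMap.range (diagonalAtOrigin H m) = LinearMap.range (totalPairing H m) :=
    le_antisymm (range_diagonalAtOrigin_le H hH) (range_totalPairing_le H hH)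
  let e : localEquivariantMaps H m ≃ₗ[ℝ]
      ⨁ κ : Weights m, (symSpaceRep H κ.1).invariants :=
    (LinearEquiv.ofInjective _ (diagonalAtOrigin_injective H)).trans
      ((LinearEquiv.ofEq _ _ hrange).trans
        (LinearEquiv.ofInjective _ (totalPairing_injective H)).symm)
  have he : ∀ φ, totalPairing H m (e φ) = diagonalAtOrigin H m φ := fun φ =>
    congrArg Subtype.val ((LinearEquiv.ofInjective _ (totalPairing_injective H)).apply_symm_apply
      (LinearEquiv.ofEq _ _ hrange (LinearEquiv.ofInjective _ (diagonalAtOrigin_injective H) φ)))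
  have := finite_weights m
  exact ⟨⟨e, fun φ f => (congrFun (he φ) f).symm⟩, Module.Finite.equiv e.symm⟩
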